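/- **Conventions.** Endomorphisms of von Neumann algebras are normal unit-preserving $*$-endomorphisms; $M_*$ denotes the space of normal linear functionals on a von Neumann algebra $M$; a UCP map is a normal, unit-preserving, completely positive linear map; a $W^*$-dynamical system $(A,\beta)$ is a $*$-automorphism $\beta$ of a von Neumann algebra $A$. An *asymptotic lift* of a UCP map $\phi:M\to M$ is a triple $(A,\beta,F)$ consisting of a $W^*$-dynamical system $(A,\beta)$ and a UCP map $F:A\to M$ such that (a) $F\circ\beta=\phi\circ F$; (b) if $x\in A$ satisfies $F(\beta^n(x))=0$ for all $n\in\mathbb Z$, then $x=0$; (c) for every $k\ge 1$ and every normal linear functional $\rho$ on $M_k(M)$, $$\lim_{n\to\infty}\|\rho\circ(\mathrm{id}_k\otimes\phi)^n\|=\|\rho\circ(\mathrm{id}_k\otimes F)\|.$$ An *asymptotic lift* of an endomorphism $\alpha:N\to N$ is a triple $(A,\beta,F)$ consisting of a $W^*$-dynamical system $(A,\beta)$ and a normal unit-preserving $*$-homomorphism $F:A\to N$ with $F\circ\beta=\alpha\circ F$ that satisfies (b), $F(A)=\bigcap_{n\ge1}\alpha^n(N)$, and $\lim_n\|\rho\circ\alpha^n\|=\|\rho\circ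 F\|$ for all $\rho\in N_*$. **Theorem.** Let $\alpha:N\to N$ be an endomorphism of a von Neumann algebra and let $p\in N$ be a projection with $\alpha(p)\ge p$ and $\alpha^n(p)\uparrow\mathbf 1$ as $n\uparrow\infty$. Let $M=pNp$ and $\phi(x)=p\alpha(x)p$ for $x\in M$. Then $\phi:M\to M$ is a UCP map. Let $N_\infty=\bigcap_{n\ge1}\alpha^n(N)$ and $K=\ker\alpha\cap N_\infty$. There are central projections $c_n$ of $N_\infty$ with $\ker\alpha^n\cap N_\infty=c_nN_\infty$, converging to an $\alpha$-fixed central projection $c$ of $N_\infty$; $\alpha$ restricts to a $*$-automorphism $\beta$ of $P=(\mathbf 1-c)N_\infty$; and there is an isomorphism of von Neumann algebras $\theta:P\oplus\ell^\infty(\mathbb N,K)\to N_\infty$ with $\theta\circ(\beta\oplus\sigma_+)=\alpha\circ\theta$, where $\sigma_+(x_1,x_2,\dots)=(x_2,x_3,\dots)$. For any such $\theta$, put $$\tilde N=P\oplus\ell^\infty(\mathbb Z,K),\qquad \tilde\alpha(x\oplus(x_n))=\beta(x)\oplus(x_{n+1}),\qquad E(x\oplus(x_n))=\theta(x\oplus(x_1,x_2,\dots)).$$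 Then $(\tilde N,\tilde\alpha,E)$ is an asymptotic lift of $\alpha$, and $(\tilde N,\tilde\alpha,\tilde E)$, where $\tilde E:\tilde N\to M$ is given by $$\tilde E(x)=pE(x)p,\qquad x\in\tilde N,$$ is an asymptotic lift of $\phi$. -/

import Mathlib

open Filter Topology
open scoped ENNReal BoundedContinuousFunction CStarAlgebra

noncomputable section

namespace AsymptoticLift

/-! ### Weak operator topologies, preduals, normal maps -/

/-- A C⋆-algebra represented by operators carries, besides its norm, the weak operator topology of
the representation. It is used only on bounded sets, where it coincides with the ultraweak
topology. -/
class WeakOp (A : Type*) where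
  /-- The weak operator topology. -/
  weakOp : TopologicalSpace A

section WeakOpInstances

variable {H : Type*} [NormedAddCommGroup H] [InnerProductSpace ℂ H]

instance : WeakOp (H →L[ℂ] H) where
  weakOp := TopologicalSpace.induced (fun T => (ContinuousLinearMapWOT.ofCLM T : H →WOT[ℂ] H))
    ContinuousLinearMapWOT.instTopologicalSpace

/-- A `*`-subalgebra inherits the topology of the ambient algebra. -/
instance {A : Type*} [CStarAlgebra A] [WeakOp A] (S : StarSubalgebra ℂ A) : WeakOp S where
  weakOp := TopologicalSpace.induced ((↑) : S → A) WeakOp.weakOp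

/-- On bounded subsets of a direct sum `A ⊕ B`, acting on the direct sum of the two Hilbert spaces,
the weak operator topology is the product topology. -/
instance {A B : Type*} [WeakOp A] [WeakOp B] : WeakOp (A × B) where
  weakOp := @instTopologicalSpaceProd A B WeakOp.weakOp WeakOp.weakOp

/-- On bounded subsets of `ℓ^∞(I, A)`, acting diagonally on the direct sum of `I` copies of the
Hilbert space of `A`, the weak operator topology is the topology of coordinatewise convergence. -/
instance {I A : Type*} [TopologicalSpace I] [CStarAlgebra A] [WeakOp A] : WeakOp (I →ᵇ A) where
  weakOp := TopologicalSpace.induced (fun (f : I →ᵇ A) (i : I) => f i)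
    (@Pi.topologicalSpace I (fun _ => A) fun _ => WeakOp.weakOp)

end WeakOpInstances

section Normal

variable (A : Type*) [CStarAlgebra A] [WeakOp A]

/-- The space `A_*` of normal linear functionals: the bounded linear functionals that are weak
operator continuous on the unit ball (equivalently, the ultraweakly continuous ones). -/
def predual : Submodule ℂ (StrongDual ℂ A) where
  carrier := {ρ | @ContinuousOn A ℂ WeakOp.weakOp _ ρ (Metric.closedBall 0 1)}
  add_mem' {ρ σ} hρ hσ := by
    let _ : TopologicalSpace A := WeakOp.weakOp
    exact ContinuousOn.add (f := fun a => ρ a) (g := fun a => σ a) hρ hσ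
  zero_mem' := by
    let _ : TopologicalSpace A := WeakOp.weakOp
    exact continuousOn_const (c := (0 : ℂ))
  smul_mem' c ρ hρ := by
    let _ : TopologicalSpace A := WeakOp.weakOp
    exact ContinuousOn.const_smul (g := fun a => ρ a) hρ c

/-- `A` is a von Neumann algebra with predual `A_*`: the canonical map `a ↦ (ρ ↦ ρ a)` from `A` to
the Banach space dual of `A_*` is injective, and every functional on `A_*` of norm at most `C` is
the image of an element of norm at most `C`. In other words, this (obviously contractive) map is an
isometric bijection. -/
structure IsVonNeumann : Prop where
  injective : ∀ a : A, (∀ ρ ∈ predual A, ρ a = 0) → a = 0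
  surjective : ∀ (l : predual A →ₗ[ℂ] ℂ) (C : ℝ), 0 ≤ C →
    (∀ ρ, ‖l ρ‖ ≤ C * ‖(ρ : StrongDual ℂ A)‖) →
    ∃ a : A, ‖a‖ ≤ C ∧ ∀ ρ, l ρ = (ρ : StrongDual ℂ A) a

variable {A} {B : Type*} [CStarAlgebra B] [WeakOp B]

/-- A (linear) map is normal if it pulls normal functionals back to normal functionals. -/
def IsNormalMap (Φ : A → B) : Prop :=
  ∀ ρ ∈ predual B, ∃ σ ∈ predual A, ∀ a, σ a = ρ (Φ a)

end Normal

/-! ### UCP maps and their asymptotic lifts -/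

section UCP

attribute [local instance] CStarAlgebra.spectralOrder CStarAlgebra.spectralOrderedRing

/-- UCP maps: normal, unit-preserving, completely positive linear maps. -/
structure IsUCP {A B : Type*} [CStarAlgebra A] [WeakOp A] [CStarAlgebra B] [WeakOp B]
    (Φ : A →ₗ[ℂ] B) : Prop where
  map_one : Φ 1 = 1
  completelyPositive : ∃ Ψ : A →CP B, ∀ a, Ψ a = Φ a
  normal : IsNormalMap Φ

/-- The normal linear functional on `M_k(B)` with coefficients `ρ i j ∈ B_*`. -/
def matrixFunctional {B : Type*} [CStarAlgebra B] [WeakOp B] {k : ℕ}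
    (ρ : Fin k → Fin k → predual B) (X : CStarMatrix (Fin k) (Fin k) B) : ℂ :=
  ∑ i, ∑ j, (ρ i j : StrongDual ℂ B) (X i j)

/-- The norm of the functional `ρ ∘ (id_k ⊗ Φ)` on the C⋆-algebra `M_k(A)`, where `ρ` is a normal
functional on `M_k(B)`. -/
def normComp {A B : Type*} [CStarAlgebra A] [CStarAlgebra B] [WeakOp B] {k : ℕ}
    (ρ : Fin k → Fin k → predual B) (Φ : A →ₗ[ℂ] B) : ℝ≥0∞ :=
  ⨆ X : CStarMatrix (Fin k) (Fin k) A, ⨆ _ : ‖X‖ ≤ 1, ‖matrixFunctional ρ (X.map Φ)‖ₑ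

/-- `(A, β, E)` is an asymptotic lift of the UCP map `L : M → M`: it is a `W⋆`-dynamical system
`(A, β)` with a UCP map `E : A → M` satisfying `E ∘ β = L ∘ E`, it is nondegenerate, and
`lim ‖ρ ∘ (id_k ⊗ L)^n‖ = ‖ρ ∘ (id_k ⊗ E)‖` for every normal linear functional `ρ` on every matrix
algebra `M_k(M)`. -/
structure IsAsymptoticLift {A M : Type*} [CStarAlgebra A] [WeakOp A] [CStarAlgebra M] [WeakOp M]
    (L : M →ₗ[ℂ] M) (β : A ≃⋆ₐ[ℂ] A) (E : A →ₗ[ℂ] M) : Prop where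
  isVonNeumann : IsVonNeumann A
  normal : IsNormalMap β
  normal_symm : IsNormalMap β.symm
  ucp : IsUCP E
  equivariant : ∀ x, E (β x) = L (E x)
  nondegenerate : ∀ x, (∀ n : ℤ, E ((β ^ n) x) = 0) → x = 0
  tendsto_norm : ∀ (k : ℕ) (ρ : Fin k → Fin k → predual M),
    Tendsto (fun n : ℕ => normComp ρ (L ^ n)) atTop (𝓝 (normComp ρ E))

end UCP

/-! ### Corners and ideals -/

/-- A unital C⋆-algebra contained in `A`, whose unit need not be the unit of `A`. -/
structure SubCStar (A : Type*) [CStarAlgebra A] extends NonUnitalStarSubalgebra ℂ A where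
  /-- The unit. -/
  e : A
  isClosed' : IsClosed carrier
  e_mem : e ∈ carrier
  e_mul : ∀ x ∈ carrier, e * x = x
  mul_e : ∀ x ∈ carrier, x * e = x

namespace SubCStar

variable {A : Type*} [CStarAlgebra A] (S : SubCStar A)

/-- The type of elements of `S`. -/
def Elem : Type _ := S.toNonUnitalStarSubalgebra

instance : CoeSort (SubCStar A) (Type _) := ⟨Elem⟩

instance : IsClosed (S.toNonUnitalStarSubalgebra : Set A) := S.isClosed'

/-- Auxiliary for the C⋆-algebra structure. -/
abbrev auxNonUnital : NonUnitalCStarAlgebra S :=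
  inferInstanceAs (NonUnitalCStarAlgebra S.toNonUnitalStarSubalgebra)

/-- Auxiliary for the C⋆-algebra structure. -/
abbrev auxRing : Ring S :=
  letI := S.auxNonUnital
  { (inferInstance : NonUnitalRing S) with
    one := ⟨S.e, S.e_mem⟩
    one_mul := fun x => Subtype.ext (S.e_mul x.1 x.2)
    mul_one := fun x => Subtype.ext (S.mul_e x.1 x.2) }

instance : CStarAlgebra S :=
  letI := S.auxNonUnital
  letI := S.auxRing
  { S.auxNonUnital, S.auxRing with
    algebraMap :=
      { toFun := fun r => r • (1 : S)
        map_one' := one_smul ℂ _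
        map_mul' := fun r s => Subtype.ext (by
          change (r * s) • S.e = (r • S.e) * (s • S.e)
          rw [smul_mul_smul_comm, S.e_mul _ S.e_mem])
        map_zero' := zero_smul ℂ _
        map_add' := fun r s => add_smul r s _ }
    commutes' := fun r x => Subtype.ext (by
      change (r • S.e) * x.1 = x.1 * (r • S.e)
      rw [smul_mul_assoc, mul_smul_comm, S.e_mul _ x.2, S.mul_e _ x.2])
    smul_def' := fun r x => Subtype.ext (by
      change r • x.1 = (r • S.e) * x.1
      rw [smul_mul_assoc, S.e_mul _ x.2]) }

/-- The inclusion of `S` in `A`. -/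
def incl : S →ₗ[ℂ] A where
  toFun x := x.1
  map_add' _ _ := rfl
  map_smul' _ _ := rfl

/-- The weak operator topology on `S` is inherited from `A`. -/
instance [WeakOp A] : WeakOp S where
  weakOp := TopologicalSpace.induced S.incl WeakOp.weakOp

end SubCStar

/-- The corner `pAp` defined by a projection `p`. -/
def corner {A : Type*} [CStarAlgebra A] (p : A) (hp : IsStarProjection p) : SubCStar A where
  carrier := {x | ∃ y, x = p * y * p}
  add_mem' := by
    rintro _ _ ⟨x, rfl⟩ ⟨y, rfl⟩
    exact ⟨x + y, by rw [mul_add, add_mul]⟩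
  zero_mem' := ⟨0, by simp⟩
  mul_mem' := by
    rintro _ _ ⟨x, rfl⟩ ⟨y, rfl⟩
    exact ⟨x * p * (p * y), by simp only [mul_assoc]⟩
  smul_mem' := by
    rintro c _ ⟨x, rfl⟩
    exact ⟨c • x, by simp⟩
  star_mem' := by
    rintro _ ⟨x, rfl⟩
    exact ⟨star x, by simp [hp.isSelfAdjoint.star_eq, mul_assoc]⟩
  e := p
  isClosed' := by
    have h : {x | ∃ y, x = p * y * p} = {x | p * x * p = x} := by
      ext x
      constructor
      · rintro ⟨y, rfl⟩
        change p * (p * y * p) * p = p * y * p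
        have h1 : p * p = p := hp.isIdempotentElem
        calc p * (p * y * p) * p = (p * p) * y * (p * p) := by simp only [mul_assoc]
          _ = _ := by rw [h1]
      · intro hx
        exact ⟨x, Eq.symm hx⟩
    change IsClosed {x | ∃ y, x = p * y * p}
    rw [h]
    exact isClosed_eq (by fun_prop) continuous_id
  e_mem := ⟨1, by rw [mul_one]; exact hp.isIdempotentElem.symm⟩
  e_mul := by
    rintro _ ⟨y, rfl⟩
    have h1 : p * p = p := hp.isIdempotentElem
    rw [← mul_assoc, ← mul_assoc, h1]
  mul_e := by
    rintro _ ⟨y, rfl⟩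
    have h1 : p * p = p := hp.isIdempotentElem
    rw [mul_assoc, h1]

/-- The compression `x ↦ pxp` of `A` onto `pAp`. -/
def compress {A : Type*} [CStarAlgebra A] (p : A) (hp : IsStarProjection p) :
    A →ₗ[ℂ] corner p hp where
  toFun x := ⟨p * x * p, x, rfl⟩
  map_add' x y := Subtype.ext (by
    change p * (x + y) * p = p * x * p + p * y * p
    rw [mul_add, add_mul])
  map_smul' c x := Subtype.ext (by
    change p * (c • x) * p = c • (p * x * p)
    simp)

/-- The map `φ(x) = p α(x) p` on `pAp`. -/
def compressedEndo {A : Type*} [CStarAlgebra A] (α : A →⋆ₐ[ℂ] A) (p : A)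
    (hp : IsStarProjection p) : corner p hp →ₗ[ℂ] corner p hp where
  toFun x := compress p hp (α ((corner p hp).incl x))
  map_add' x y := by simp only [map_add]
  map_smul' c x := by simp only [map_smul, RingHom.id_apply]

/-! ### The tail algebra -/

/-- The range of a `*`-homomorphism of C⋆-algebras is closed. -/
theorem isClosed_range {A B : Type*} [CStarAlgebra A] [CStarAlgebra B] (φ : A →⋆ₐ[ℂ] B) :
    IsClosed (Set.range φ) := by
  have hsa : ∀ a : A, IsSelfAdjoint a → ∃ a' : A, φ a' = φ a ∧ ‖a'‖ ≤ ‖φ a‖ := by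
    intro a ha
    let f : ℝ → ℝ := fun t => max (-‖φ a‖) (min t ‖φ a‖)
    have hf : Continuous f := by fun_prop
    have hb : IsSelfAdjoint (φ a) := ha.map φ
    refine ⟨cfc f a, ?_, ?_⟩
    · have hφ : Continuous φ := map_continuous φ
      rw [StarAlgHomClass.map_cfc φ f a]
      conv_rhs => rw [← cfc_id ℝ (φ a)]
      refine cfc_congr fun t ht => ?_
      have : Nontrivial B := by
        by_contra hB
        rw [not_nontrivial_iff_subsingleton] at hB
        simp [spectrum.of_subsingleton] at ht
      have h1 : ‖t‖ ≤ ‖φ a‖ := spectrum.norm_le_norm_of_mem ht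
      rw [Real.norm_eq_abs, abs_le] at h1
      simp [f, h1.1, h1.2]
    · refine norm_cfc_le (norm_nonneg _) fun t _ => ?_
      rw [Real.norm_eq_abs, abs_le]
      exact ⟨le_max_left _ _, max_le (by linarith [norm_nonneg (φ a)]) (min_le_right _ _)⟩
  have hlift : ∀ a : A, ∃ a' : A, φ a' = φ a ∧ ‖a'‖ ≤ 2 * ‖φ a‖ := by
    intro a
    obtain ⟨x, hx, hx'⟩ := hsa (realPart a) (realPart a).2
    obtain ⟨y, hy, hy'⟩ := hsa (imaginaryPart a) (imaginaryPart a).2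
    refine ⟨x + Complex.I • y, ?_, ?_⟩
    · rw [map_add, map_smul, hx, hy, ← map_smul, ← map_add, realPart_add_I_smul_imaginaryPart]
    · have h1 : ‖φ (realPart a : A)‖ ≤ ‖φ a‖ := by
        have h : φ (realPart a : A) = (realPart (φ a) : B) := by
          rw [realPart_apply_coe, realPart_apply_coe, ← map_star, ← map_add]
          exact map_real_smul φ (map_continuous φ) _ _
        rw [h]
        exact realPart.norm_le (φ a)
      have h2 : ‖φ (imaginaryPart a : A)‖ ≤ ‖φ a‖ := by
        have h : φ (imaginaryPart a : A) = (imaginaryPart (φ a) : B) := by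
          rw [imaginaryPart_apply_coe, imaginaryPart_apply_coe, ← map_star, ← map_sub, map_smul]
          exact congrArg _ (map_real_smul φ (map_continuous φ) _ _)
        rw [h]
        exact imaginaryPart.norm_le (φ a)
      calc ‖x + Complex.I • y‖ ≤ ‖x‖ + ‖Complex.I • y‖ := norm_add_le _ _
        _ = ‖x‖ + ‖y‖ := by rw [norm_smul, Complex.norm_I, one_mul]
        _ ≤ 2 * ‖φ a‖ := by linarith
  let g : NormedAddGroupHom A B :=
    { toFun := φ
      map_add' := map_add φ
      bound' := ⟨1, fun a => by rw [one_mul]; exact NonUnitalStarAlgHom.norm_apply_le φ a⟩ }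
  have hg : g.SurjectiveOnWith g.range 2 := by
    rintro _ ⟨a, rfl⟩
    exact hlift a
  have hcl := controlled_closure_of_complete two_pos one_pos hg
  refine isClosed_of_closure_subset fun b hb => ?_
  obtain ⟨a, ha, _⟩ := hcl b hb
  exact ⟨a, ha⟩

section Tail

variable {A : Type*} [CStarAlgebra A] (α : A →⋆ₐ[ℂ] A)

/-- The tail algebra `⋂ n, α^n(A)`. -/
def tail : StarSubalgebra ℂ A := ⨅ n : ℕ, (α ^ n).range

instance isClosed_tail : IsClosed (tail α : Set A) := by
  have h : (tail α : Set A) = ⋂ n : ℕ, Set.range (α ^ n) := by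
    simp only [tail, StarSubalgebra.coe_iInf]
    rfl
  rw [h]
  exact isClosed_iInter fun n => isClosed_range (α ^ n)

variable [WeakOp A]

/-- The central projections `c_n` of the tail algebra `A_∞` that satisfy
`ker α^n ∩ A_∞ = c_n A_∞`, and their limit `c`, an `α`-fixed central projection of `A_∞`. -/
structure KernelProjections where
  /-- The unit of the ideal `ker α^n ∩ A_∞`. -/
  cn : ℕ → A
  /-- The limit of the sequence `cn`. -/
  c : A
  cn_proj : ∀ n, IsStarProjection (cn n)
  cn_mem : ∀ n, cn n ∈ tail α
  cn_central : ∀ n, ∀ x ∈ tail α, cn n * x = x * cn n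
  cn_ker : ∀ n, ∀ x ∈ tail α, (α ^ n) x = 0 ↔ ∃ y ∈ tail α, x = cn n * y
  c_proj : IsStarProjection c
  c_mem : c ∈ tail α
  c_central : ∀ x ∈ tail α, c * x = x * c
  c_fixed : α c = c
  c_limit : Tendsto cn atTop (@nhds A WeakOp.weakOp c)

namespace KernelProjections

variable {α} (k : KernelProjections α)

/-- `K = ker α ∩ A_∞`, with unit `c_1`. -/
def K : SubCStar A where
  carrier := {x | x ∈ tail α ∧ α x = 0}
  add_mem' hx hy := ⟨add_mem hx.1 hy.1, by rw [map_add, hx.2, hy.2, add_zero]⟩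
  zero_mem' := ⟨zero_mem _, map_zero α⟩
  mul_mem' hx hy := ⟨mul_mem hx.1 hy.1, by rw [map_mul, hx.2, zero_mul]⟩
  smul_mem' r x hx := ⟨SMulMemClass.smul_mem r hx.1, by rw [map_smul, hx.2, smul_zero]⟩
  star_mem' hx := ⟨star_mem hx.1, by rw [map_star, hx.2, star_zero]⟩
  e := k.cn 1
  isClosed' := (isClosed_tail α).inter
    (isClosed_eq (map_continuous α) continuous_const)
  e_mem := by
    refine ⟨k.cn_mem 1, ?_⟩
    have h := (k.cn_ker 1 (k.cn 1) (k.cn_mem 1)).2 ⟨1, one_mem _, (mul_one _).symm⟩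
    simpa using h
  e_mul := by
    rintro x ⟨hx, hx0⟩
    obtain ⟨y, _, rfl⟩ := (k.cn_ker 1 x hx).1 (by simpa using hx0)
    rw [← mul_assoc, (k.cn_proj 1).isIdempotentElem.eq]
  mul_e := by
    rintro x ⟨hx, hx0⟩
    obtain ⟨y, _, h⟩ := (k.cn_ker 1 x hx).1 (by simpa using hx0)
    rw [← k.cn_central 1 x hx, h, ← mul_assoc, (k.cn_proj 1).isIdempotentElem.eq]

/-- `P = (1 - c) A_∞`, with unit `1 - c`. -/
def P : SubCStar A where
  carrier := {x | ∃ y ∈ tail α, x = (1 - k.c) * y}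
  add_mem' := by
    rintro _ _ ⟨x, hx, rfl⟩ ⟨y, hy, rfl⟩
    exact ⟨x + y, add_mem hx hy, by rw [mul_add]⟩
  zero_mem' := ⟨0, zero_mem _, by rw [mul_zero]⟩
  mul_mem' := by
    rintro _ _ ⟨x, hx, rfl⟩ ⟨y, hy, rfl⟩
    exact ⟨x * ((1 - k.c) * y), mul_mem hx (mul_mem (sub_mem (one_mem _) k.c_mem) hy),
      by rw [mul_assoc]⟩
  smul_mem' := by
    rintro r _ ⟨x, hx, rfl⟩
    exact ⟨r • x, SMulMemClass.smul_mem r hx, by rw [mul_smul_comm]⟩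
  star_mem' := by
    rintro _ ⟨x, hx, rfl⟩
    refine ⟨star x, star_mem hx, ?_⟩
    have h := k.c_central (star x) (star_mem hx)
    rw [star_mul, star_sub, star_one, k.c_proj.isSelfAdjoint.star_eq, mul_sub, sub_mul, h,
      mul_one, one_mul]
  e := 1 - k.c
  isClosed' := by
    have hc : (1 - k.c) * (1 - k.c) = 1 - k.c := k.c_proj.one_sub.isIdempotentElem
    have h : {x | ∃ y ∈ tail α, x = (1 - k.c) * y} =
        (tail α : Set A) ∩ {x | (1 - k.c) * x = x} := by
      ext x
      constructor
      · rintro ⟨y, hy, rfl⟩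
        refine ⟨mul_mem (sub_mem (one_mem _) k.c_mem) hy, ?_⟩
        change (1 - k.c) * ((1 - k.c) * y) = (1 - k.c) * y
        rw [← mul_assoc, hc]
      · rintro ⟨hx, hx'⟩
        exact ⟨x, hx, Eq.symm hx'⟩
    change IsClosed {x | ∃ y ∈ tail α, x = (1 - k.c) * y}
    rw [h]
    exact (isClosed_tail α).inter (isClosed_eq (by fun_prop) continuous_id)
  e_mem := ⟨1, one_mem _, by rw [mul_one]⟩
  e_mul := by
    rintro _ ⟨y, _, rfl⟩
    rw [← mul_assoc, k.c_proj.one_sub.isIdempotentElem.eq]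
  mul_e := by
    rintro _ ⟨y, hy, rfl⟩
    have h : y * (1 - k.c) = (1 - k.c) * y := by
      rw [mul_sub, sub_mul, k.c_central y hy, mul_one, one_mul]
    rw [mul_assoc, h, ← mul_assoc, k.c_proj.one_sub.isIdempotentElem.eq]

end KernelProjections

end Tail

/-! ### Shifts -/

section Shift

variable {K : Type*} [CStarAlgebra K]

/-- Reindexing of bounded families: `x ↦ (x (f i))_i`. -/
def reindexHom {I J : Type*} [TopologicalSpace I] [DiscreteTopology I] [TopologicalSpace J]
    (f : I → J) : (J →ᵇ K) →⋆ₐ[ℂ] (I →ᵇ K) where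
  toFun x := x.compContinuous ⟨f, continuous_of_discreteTopology⟩
  map_one' := rfl
  map_mul' _ _ := rfl
  map_zero' := rfl
  map_add' _ _ := rfl
  commutes' _ := rfl
  map_star' _ := rfl

/-- The backward shift `σ₊(x₁, x₂, …) = (x₂, x₃, …)` on `ℓ^∞(ℕ, K)`; the coordinate `x_{n+1}` is
stored at the index `n`. -/
def backwardShift : (ℕ →ᵇ K) →⋆ₐ[ℂ] (ℕ →ᵇ K) := reindexHom (fun n => n + 1)

/-- The bilateral shift `σ(x_n) = (x_{n+1})` on `ℓ^∞(ℤ, K)`. -/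
def bilateralShift : (ℤ →ᵇ K) ≃⋆ₐ[ℂ] (ℤ →ᵇ K) :=
  StarAlgEquiv.ofStarAlgHom (reindexHom (fun n : ℤ => n + 1)) (reindexHom (fun n : ℤ => n - 1))
    (by
      ext x n
      change x (n - 1 + 1) = x n
      rw [sub_add_cancel])
    (by
      ext x n
      change x (n + 1 - 1) = x n
      rw [add_sub_cancel_right])

/-- The restriction `(x_n)_{n ∈ ℤ} ↦ (x₁, x₂, …)`. -/
def positivePart : (ℤ →ᵇ K) →⋆ₐ[ℂ] (ℕ →ᵇ K) := reindexHom (fun n : ℕ => (n : ℤ) + 1)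

end Shift

/-! ### The asymptotic lift of an endomorphism -/

section EndoLift

variable {A : Type*} [CStarAlgebra A] [WeakOp A]

/-- A decomposition of the restriction of `α` to its tail algebra `A_∞` as the direct sum of its
automorphic summand `(P, β)` and the backward shift based on `K = ker α ∩ A_∞`: an isomorphism of
von Neumann algebras `θ : P ⊕ ℓ^∞(ℕ, K) → A_∞` with `θ ∘ (β ⊕ σ₊) = α ∘ θ`. -/
structure TailDecomposition (α : A →⋆ₐ[ℂ] A) extends KernelProjections α where
  /-- The restriction of `α` to `P`. -/
  β : toKernelProjections.P ≃⋆ₐ[ℂ] toKernelProjections.P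
  β_eq : ∀ x, toKernelProjections.P.incl (β x) = α (toKernelProjections.P.incl x)
  /-- The conjugacy. -/
  θ : (toKernelProjections.P × (ℕ →ᵇ toKernelProjections.K)) ≃⋆ₐ[ℂ] tail α
  θ_normal : IsNormalMap θ
  θ_shift : ∀ x y, (θ (β x, backwardShift y) : A) = α (θ (x, y))

namespace TailDecomposition

variable {α : A →⋆ₐ[ℂ] A} (D : TailDecomposition α)

/-- The von Neumann algebra `P ⊕ ℓ^∞(ℤ, K)`. -/
abbrev Lift : Type _ := D.toKernelProjections.P × (ℤ →ᵇ D.toKernelProjections.K)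

/-- The automorphism `β ⊕ σ` of `P ⊕ ℓ^∞(ℤ, K)`. -/
def liftAut : D.Lift ≃⋆ₐ[ℂ] D.Lift where
  toFun x := (D.β x.1, bilateralShift x.2)
  invFun x := (D.β.symm x.1, bilateralShift.symm x.2)
  left_inv x := by simp
  right_inv x := by simp
  map_mul' x y := by simp
  map_add' x y := by simp
  map_star' x := by simp [Prod.ext_iff, map_star]
  map_smul' r x := by simp

/-- The homomorphism `E(x ⊕ (x_n)) = θ(x ⊕ (x₁, x₂, …))`, with values in `A_∞ ⊆ A`. -/
def E : D.Lift →⋆ₐ[ℂ] A :=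
  (tail α).subtype.comp ((D.θ : _ →⋆ₐ[ℂ] tail α).comp
    ((StarAlgHom.fst ℂ _ _).prod (positivePart.comp (StarAlgHom.snd ℂ _ _))))

end TailDecomposition

/-- `(B, β, E)` is an asymptotic lift of the endomorphism `α : A → A`: it is a `W⋆`-dynamical system
`(B, β)` with a normal unit-preserving `*`-homomorphism `E : B → A` satisfying `E ∘ β = α ∘ E`, it is
nondegenerate, `E(B)` is the tail algebra of `α`, and `lim ‖ρ ∘ α^n‖ = ‖ρ ∘ E‖` for every normal
linear functional `ρ` on `A`. -/
structure IsEndoAsymptoticLift {B : Type*} [CStarAlgebra B] [WeakOp B]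
    (α : A →⋆ₐ[ℂ] A) (β : B ≃⋆ₐ[ℂ] B) (E : B →⋆ₐ[ℂ] A) : Prop where
  isVonNeumann : IsVonNeumann B
  normal_E : IsNormalMap E
  equivariant : ∀ x, E (β x) = α (E x)
  nondegenerate : ∀ x, (∀ n : ℤ, E ((β ^ n) x) = 0) → x = 0
  range_eq : Set.range E = tail α
  tendsto_norm : ∀ ρ ∈ predual A,
    Tendsto (fun n : ℕ => ⨆ x : A, ⨆ _ : ‖x‖ ≤ 1, ‖ρ ((α ^ n) x)‖ₑ) atTop
      (𝓝 (⨆ y : B, ⨆ _ : ‖y‖ ≤ 1, ‖ρ (E y)‖ₑ))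

end EndoLift

/-! ### Von Neumann algebras of operators are C⋆-algebras -/

instance isClosed_vonNeumannAlgebra {H : Type*} [NormedAddCommGroup H] [InnerProductSpace ℂ H]
    [CompleteSpace H] (N : VonNeumannAlgebra H) :
    IsClosed (N.toStarSubalgebra : Set (H →L[ℂ] H)) := by
  rw [VonNeumannAlgebra.coe_toStarSubalgebra, ← N.centralizer_centralizer]
  exact Set.isClosed_centralizer _

end AsymptoticLift

end

/-! The engine is compactness: in the weak topology the unit ball of a von Neumann algebra is
compact, and normal maps are exactly those that are weakly continuous on bounded sets. These
properties are axiomatised in `IsWStar` (`IsWAlg` adds multiplication and involution), because they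
pass to weakly closed subalgebras, direct sums and bounded families, and so to `P ⊕ ℓ^∞(ℤ, K)`,
which is not presented as an algebra of operators. They imply that the algebra is the dual of its
predual.

Write `N_∞` for the tail algebra. An element of the range of a `*`-homomorphism has a preimage of at
most twice its norm. By compactness the ranges `α^n(N)`, and with them `N_∞`, contain the weak
limits of their bounded nets, and `α` maps `N_∞` onto itself (`exists_tail_preimage`). The ideals
`ker α^n ∩ N_∞` are weakly closed, so they have units `c_n`; these are central and increasing,
surjectivity gives `α(c_{n+1}) = c_n`, and they converge to an `α`-fixed `c`. Since `ker α ∩ N_∞`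
lies under `c`, `α` is bijective on `P`. Since `α^n` carries `(c_{n+1} - c_n) N_∞` isomorphically
onto `K`, the map `t ↦ ((1 - c) t, (c_1 α^n(t))_n)` is an isomorphism that turns `α` into `β ⊕ σ₊`
(`split_injective`, `split_surjective`).

Let `θ` be any such isomorphism. Passing from `ℕ` to `ℤ` makes the shift invertible; `E` forgets the
coordinates of index at most 0, but powers of the automorphism bring each of them into view, so `E`
is nondegenerate. The norms of `ρ ∘ α^n` decrease, and they dominate that of `ρ ∘ E` because `E` is
`α^n ∘ E` composed with an automorphism. Conversely, almost optimal elements `α^n(x_n)` of the unit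
ball cluster weakly at an element of the unit ball of `N_∞`, which lifts through `E` without
increase of norm. The argument works equally for matrices (`tendsto_normComp`).

For the compression, `p ≤ α(p)` gives `p α^n(pxp) p = p α^n(x) p`. Hence `φ^n` is a compression of
`α^n`, and the norm limit for `ρ` on the corner is the one for `x ↦ ρ(pxp)`. If all `p E(·) p`
vanish along an orbit, applying `α^m` shows that `α^m(p)` compresses `E(·)` to zero for each `m`,
and `α^m(p) ↑ 1` finishes. -/

noncomputable section

namespace AsymptoticLift

/-! ### Weak limits -/

section WeakLimits

/-- The neighbourhood filter in the weak operator topology. -/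
abbrev wnhds {A : Type*} [WeakOp A] (a : A) : Filter A := @nhds A WeakOp.weakOp a

/-- A bounded functional that is continuous in the weak operator topology. -/
def IsWCont {A : Type*} [CStarAlgebra A] [WeakOp A] (ρ : StrongDual ℂ A) : Prop :=
  ∀ a, Tendsto ρ (wnhds a) (𝓝 (ρ a))

/-- The weak operator topology is generated by a separating family of functionals, and the unit
ball is compact. -/
class IsWStar (A : Type*) [CStarAlgebra A] [WeakOp A] : Prop where
  le_wnhds : ∀ (l : Filter A) (a : A),
    (∀ ρ : StrongDual ℂ A, IsWCont ρ → Tendsto ρ l (𝓝 (ρ a))) → l ≤ wnhds a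
  separating : ∀ a : A, (∀ ρ : StrongDual ℂ A, IsWCont ρ → ρ a = 0) → a = 0
  compact : ∀ u : Ultrafilter A, (∀ᶠ x in (u : Filter A), ‖x‖ ≤ 1) →
    ∃ a : A, ‖a‖ ≤ 1 ∧ (u : Filter A) ≤ wnhds a

/-- Multiplication is separately continuous, and the involution is continuous, in the weak operator
topology. -/
class IsWAlg (A : Type*) [CStarAlgebra A] [WeakOp A] : Prop extends IsWStar A where
  mul_left : ∀ a b : A, Tendsto (fun x => b * x) (wnhds a) (wnhds (b * a))
  mul_right : ∀ a b : A, Tendsto (fun x => x * b) (wnhds a) (wnhds (a * b))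
  star : ∀ a : A, Tendsto (fun x => Star.star x) (wnhds a) (wnhds (Star.star a))

/-- Continuity on bounded sets in the weak operator topologies. -/
def IsWMap {A B : Type*} [CStarAlgebra A] [WeakOp A] [CStarAlgebra B] [WeakOp B] (Φ : A → B) :
    Prop :=
  ∀ (l : Filter A) (a : A) (C : ℝ), (∀ᶠ x in l, ‖x‖ ≤ C) → ‖a‖ ≤ C → l ≤ wnhds a →
    Tendsto Φ l (wnhds (Φ a))

variable {A B : Type*} [CStarAlgebra A] [WeakOp A] [CStarAlgebra B] [WeakOp B]

theorem IsWCont.mem_predual {ρ : StrongDual ℂ A} (h : IsWCont ρ) : ρ ∈ predual A :=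
  fun a _ => (h a).mono_left (@nhdsWithin_le_nhds A WeakOp.weakOp a _)

theorem wnhds_smul [IsWStar A] (r : ℂ) (a : A) :
    Tendsto (fun x => r • x) (wnhds a) (wnhds (r • a)) := by
  refine IsWStar.le_wnhds _ _ fun ρ hρ => ?_
  rw [tendsto_map'_iff]
  simpa [Function.comp_def] using (hρ a).const_mul r

theorem wnhds_sum [IsWStar A] {ι κ : Type*} {l : Filter ι} (s : Finset κ) {f : κ → ι → A}
    {a : κ → A} (hf : ∀ k ∈ s, Tendsto (f k) l (wnhds (a k))) :
    Tendsto (fun i => ∑ k ∈ s, f k i) l (wnhds (∑ k ∈ s, a k)) := by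
  refine IsWStar.le_wnhds _ _ fun ρ hρ => ?_
  rw [tendsto_map'_iff]
  simpa [Function.comp_def] using tendsto_finsetSum s fun k hk => (hρ (a k)).comp (hf k hk)

theorem wnhds_of_tendsto [IsWStar A] {ι : Type*} {l : Filter ι} {f : ι → A} {a : A}
    (hf : Tendsto f l (𝓝 a)) : Tendsto f l (wnhds a) := by
  refine IsWStar.le_wnhds _ _ fun ρ _ => ?_
  rw [tendsto_map'_iff]
  exact (ρ.continuous.tendsto a).comp hf

theorem wnhds_const {ι X : Type*} [WeakOp X] {l : Filter ι} (a : X) :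
    Tendsto (fun _ : ι => a) l (wnhds a) :=
  @tendsto_const_nhds X WeakOp.weakOp ι a l

theorem wlim_unique [IsWStar A] {ι : Type*} {l : Filter ι} [l.NeBot] {f : ι → A} {a b : A}
    (ha : Tendsto f l (wnhds a)) (hb : Tendsto f l (wnhds b)) : a = b := by
  rw [← sub_eq_zero]
  refine IsWStar.separating _ fun ρ hρ => ?_
  rw [map_sub, sub_eq_zero]
  exact tendsto_nhds_unique ((hρ a).comp ha) ((hρ b).comp hb)

theorem exists_wlim_filter [IsWStar A] (u : Ultrafilter A) {C : ℝ}
    (hu : ∀ᶠ x in (u : Filter A), ‖x‖ ≤ C) :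
    ∃ a : A, ‖a‖ ≤ C ∧ (u : Filter A) ≤ wnhds a := by
  have hC : 0 ≤ C := by
    obtain ⟨x, hx⟩ := hu.exists
    exact (norm_nonneg x).trans hx
  -- Radius zero cannot be rescaled to radius one; there the ultrafilter is concentrated at 0.
  rcases hC.eq_or_lt with rfl | hC
  · refine ⟨0, by simp, fun s hs => ?_⟩
    filter_upwards [hu] with x hx
    rw [norm_le_zero_iff.1 hx]
    exact @mem_of_mem_nhds A WeakOp.weakOp _ _ hs
  · have hC' : (C : ℂ) ≠ 0 := by exact_mod_cast hC.ne'
    obtain ⟨b, hb, hub⟩ := IsWStar.compact (u.map fun x => (C : ℂ)⁻¹ • x) (by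
      change ∀ᶠ x in (u : Filter A), ‖(C : ℂ)⁻¹ • x‖ ≤ 1
      filter_upwards [hu] with x hx
      rw [norm_smul, norm_inv, Complex.norm_real, Real.norm_of_nonneg hC.le]
      rwa [inv_mul_le_iff₀ hC, mul_one])
    refine ⟨(C : ℂ) • b, ?_, ?_⟩
    · rw [norm_smul, Complex.norm_real, Real.norm_of_nonneg hC.le]
      exact mul_le_of_le_one_right hC.le hb
    · have h := (wnhds_smul (C : ℂ) b).comp (show Tendsto (fun x => (C : ℂ)⁻¹ • x) (u : Filter A) _
        from hub)
      have h2 : (fun x : A => (C : ℂ) • x) ∘ (fun x => (C : ℂ)⁻¹ • x) = id := by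
        ext x
        exact smul_inv_smul₀ hC' x
      rw [h2] at h
      exact h

theorem exists_wlim [IsWStar A] {ι : Type*} (u : Ultrafilter ι) (f : ι → A) {C : ℝ}
    (hu : ∀ᶠ i in (u : Filter ι), ‖f i‖ ≤ C) :
    ∃ a : A, ‖a‖ ≤ C ∧ Tendsto f u (wnhds a) :=
  exists_wlim_filter (u.map f) hu

theorem norm_le_of_wlim [IsWStar A] {ι : Type*} {l : Filter ι} [l.NeBot] {f : ι → A} {a : A}
    {C : ℝ} (hf : ∀ᶠ i in l, ‖f i‖ ≤ C) (ha : Tendsto f l (wnhds a)) : ‖a‖ ≤ C := by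
  obtain ⟨b, hb, h⟩ := exists_wlim (Ultrafilter.of l) f (Ultrafilter.of_le l hf)
  rwa [wlim_unique (ha.mono_left (Ultrafilter.of_le l)) h]

/-- A sequence or net that stays in a ball and all of whose cluster points equal `a` converges
weakly to `a`. -/
theorem tendsto_wnhds_of_ultrafilter [IsWStar A] {ι : Type*} {l : Filter ι} {f : ι → A} {a : A}
    {C : ℝ} (hf : ∀ᶠ i in l, ‖f i‖ ≤ C)
    (h : ∀ u : Ultrafilter ι, ↑u ≤ l → ∀ b, Tendsto f u (wnhds b) → b = a) :
    Tendsto f l (wnhds a) := by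
  rw [tendsto_iff_ultrafilter]
  intro u hu
  obtain ⟨b, _, hb⟩ := exists_wlim u f (hu hf)
  rwa [← h u hu b hb]

/-- A normal functional is continuous only on the unit ball, so the net is first divided by `max C
1`, which is positive whatever `C` is. -/
theorem predual_tendsto [IsWStar A] {ρ : StrongDual ℂ A} (hρ : ρ ∈ predual A) {ι : Type*}
    {l : Filter ι} {f : ι → A} {a : A} {C : ℝ} (hf : ∀ᶠ i in l, ‖f i‖ ≤ C)
    (ha : Tendsto f l (wnhds a)) : Tendsto (fun i => ρ (f i)) l (𝓝 (ρ a)) := by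
  rcases l.eq_or_neBot with rfl | hl
  · exact tendsto_bot
  have haC := norm_le_of_wlim hf ha
  have hD : 0 < max C 1 := lt_max_of_lt_right one_pos
  set D := max C 1
  have hD' : (D : ℂ) ≠ 0 := by exact_mod_cast hD.ne'
  have key : ∀ x : A, ‖x‖ ≤ C → (D : ℂ)⁻¹ • x ∈ Metric.closedBall (0 : A) 1 := by
    intro x hx
    rw [mem_closedBall_zero_iff, norm_smul, norm_inv, Complex.norm_real, Real.norm_of_nonneg hD.le,
      inv_mul_le_iff₀ hD, mul_one]
    exact hx.trans (le_max_left _ _)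
  have h1 := hρ ((D : ℂ)⁻¹ • a) (key a haC)
  have h2 : Tendsto (fun i => (D : ℂ)⁻¹ • f i) l
      (@nhdsWithin A WeakOp.weakOp ((D : ℂ)⁻¹ • a) (Metric.closedBall (0 : A) 1)) := by
    refine tendsto_inf.2 ⟨(wnhds_smul _ a).comp ha, tendsto_principal.2 ?_⟩
    filter_upwards [hf] with i hi using key _ hi
  have h3 := (Tendsto.comp h1 h2).const_mul (D : ℂ)
  simpa [Function.comp_def, hD'] using h3

theorem IsWMap.tendsto [IsWStar A] {Φ : A → B} (h : IsWMap Φ) {ι : Type*}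
    {l : Filter ι} {f : ι → A} {a : A} {C : ℝ} (hf : ∀ᶠ i in l, ‖f i‖ ≤ C)
    (ha : Tendsto f l (wnhds a)) : Tendsto (fun i => Φ (f i)) l (wnhds (Φ a)) := by
  rcases l.eq_or_neBot with rfl | hl
  · exact tendsto_bot
  exact h (l.map f) a C hf (norm_le_of_wlim hf ha) ha

theorem IsWMap.isNormalMap [IsWStar B] {Φ : A →L[ℂ] B} (h : IsWMap Φ) : IsNormalMap Φ := by
  intro ρ hρ
  refine ⟨ρ.comp Φ, ?_, fun a => rfl⟩
  intro a ha
  have hball : ∀ᶠ x in @nhdsWithin A WeakOp.weakOp a (Metric.closedBall 0 1), ‖x‖ ≤ 1 := by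
    filter_upwards [@self_mem_nhdsWithin A WeakOp.weakOp a _] with x hx
    simpa using hx
  refine predual_tendsto hρ (C := ‖Φ‖) (f := Φ)
    (l := @nhdsWithin A WeakOp.weakOp a (Metric.closedBall 0 1)) ?_ ?_
  · filter_upwards [hball] with x hx
    exact (Φ.le_opNorm x).trans (mul_le_of_le_one_right (norm_nonneg _) hx)
  · exact h _ a 1 hball (by simpa using ha) (@nhdsWithin_le_nhds A WeakOp.weakOp a _)

/-- Weakly continuous functionals are normal and determine the weak topology, so it suffices to test
against them. With the converse `IsWMap.isNormalMap`, normality becomes weak continuity on bounded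
sets. -/
theorem isWMap_of_isNormalMap [IsWStar A] [IsWStar B] {Φ : A → B} (h : IsNormalMap Φ) :
    IsWMap Φ := by
  intro l a C hl _ hla
  refine IsWStar.le_wnhds _ _ fun ρ hρ => ?_
  rw [tendsto_map'_iff]
  obtain ⟨σ, hσ, hσρ⟩ := h ρ hρ.mem_predual
  have := predual_tendsto hσ (f := id) hl hla
  simpa [Function.comp_def, hσρ] using this

theorem isNormalMap_comp {C : Type*} [CStarAlgebra C] [WeakOp C] {Φ : A → B} {Ψ : B → C}
    (hΨ : IsNormalMap Ψ) (hΦ : IsNormalMap Φ) : IsNormalMap (fun a => Ψ (Φ a)) := by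
  intro ρ hρ
  obtain ⟨σ, hσ, h1⟩ := hΨ ρ hρ
  obtain ⟨τ, hτ, h2⟩ := hΦ σ hσ
  exact ⟨τ, hτ, fun a => by rw [h2, h1]⟩

theorem isNormalMap_id : IsNormalMap (fun a : A => a) := fun ρ hρ => ⟨ρ, hρ, fun _ => rfl⟩

theorem isNormalMap_pow {α : A →⋆ₐ[ℂ] A} (h : IsNormalMap α) (n : ℕ) :
    IsNormalMap (α ^ n : A →⋆ₐ[ℂ] A) := by
  induction n with
  | zero => exact isNormalMap_id
  | succ n ih =>
    rw [pow_succ]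
    exact isNormalMap_comp (Ψ := (α ^ n : A →⋆ₐ[ℂ] A)) ih h

/-- The inverse of a weakly continuous `*`-isomorphism is weakly continuous. -/
theorem IsWMap.symm [IsWStar A] [IsWStar B] {Φ : A ≃⋆ₐ[ℂ] B} (h : IsWMap Φ) : IsWMap Φ.symm := by
  intro l b C hl _ hlb
  have hn : ∀ x, ‖Φ.symm x‖ = ‖x‖ := NonUnitalStarAlgHom.norm_map Φ.symm Φ.symm.injective
  -- The inverse is isometric, so the preimages stay bounded, and `Φ` sends each of their cluster
  -- points to `b`.
  refine tendsto_wnhds_of_ultrafilter (C := C) (by simpa only [hn] using hl) fun u hu a ha => ?_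
  have h1 : Tendsto (fun x => Φ (Φ.symm x)) u (wnhds (Φ a)) :=
    h.tendsto (by simp only [hn]; exact hu hl) ha
  simp only [StarAlgEquiv.apply_symm_apply] at h1
  rw [wlim_unique (l := (u : Filter B)) (f := fun x => x) (hu.trans hlb) h1,
    StarAlgEquiv.symm_apply_apply]

theorem StarAlgHom.isNormalMap_of_isWMap [IsWStar B] {Φ : A →⋆ₐ[ℂ] B} (h : IsWMap Φ) :
    IsNormalMap Φ :=
  IsWMap.isNormalMap
    (Φ := LinearMap.mkContinuous (Φ.toAlgHom.toLinearMap) 1 fun x => by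
      rw [one_mul]
      exact NonUnitalStarAlgHom.norm_apply_le Φ x) h

theorem StarAlgEquiv.isNormalMap_of_isWMap [IsWStar B] {Φ : A ≃⋆ₐ[ℂ] B} (h : IsWMap Φ) :
    IsNormalMap Φ :=
  StarAlgHom.isNormalMap_of_isWMap (Φ := (Φ : A →⋆ₐ[ℂ] B)) h

end WeakLimits

/-! ### The dual of the predual -/

section Dual

variable {A : Type*} [CStarAlgebra A] [WeakOp A]

theorem isCompact_weak_closedBall [IsWStar A] :
    @IsCompact A WeakOp.weakOp (Metric.closedBall (0 : A) 1) := by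
  rw [@isCompact_iff_ultrafilter_le_nhds A WeakOp.weakOp]
  intro u hu
  rw [le_principal_iff] at hu
  obtain ⟨a, ha, hua⟩ := IsWStar.compact u (by
    filter_upwards [hu] with x hx
    simpa using hx)
  exact ⟨a, by simpa using ha, hua⟩

/-- A unimodular scalar rotates `ρ x` onto the positive axis, so real parts on the ball control the
norm. Hahn–Banach separation supplies bounds on real parts only. -/
theorem norm_mul_le_of_re_le {V : Type*} [NormedAddCommGroup V] [NormedSpace ℂ V]
    {ρ : StrongDual ℂ V} {C r : ℝ} (hC : 0 ≤ C)
    (h : ∀ a, ‖a‖ ≤ 1 → C * (ρ a).re ≤ r) : C * ‖ρ‖ ≤ r := by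
  have hr : 0 ≤ r := by simpa using h 0 (by simp)
  rcases hC.eq_or_lt with rfl | hC
  · simpa using hr
  rw [← le_div_iff₀' hC]
  refine ContinuousLinearMap.opNorm_le_of_unit_norm (by positivity) fun x hx => ?_
  rw [le_div_iff₀' hC]
  obtain ⟨c, hc, hcx⟩ : ∃ c : ℂ, ‖c‖ = 1 ∧ c * ρ x = ‖ρ x‖ := RCLike.exists_norm_eq_mul_self (ρ x)
    |>.imp fun c hc => ⟨hc.1, hc.2.symm⟩
  have := h (c • x) (by rw [norm_smul, hc, hx, one_mul])
  rw [map_smul, smul_eq_mul, hcx, Complex.ofReal_re] at this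
  exact this

open scoped Pointwise in
/-- Every functional on the predual is, on finite sets, evaluation at an element of the algebra of
no larger norm. -/
theorem exists_eval_on_finset [IsWStar A] (l : predual A →ₗ[ℂ] ℂ) {C : ℝ} (hC : 0 ≤ C)
    (hl : ∀ ρ, ‖l ρ‖ ≤ C * ‖(ρ : StrongDual ℂ A)‖) (s : Finset (predual A)) :
    ∃ a : A, ‖a‖ ≤ C ∧ ∀ ρ ∈ s, l ρ = (ρ : StrongDual ℂ A) a := by
  classical
  let f : A →ₗ[ℂ] (s → ℂ) := LinearMap.pi fun ρ => ((ρ.1 : StrongDual ℂ A) : A →ₗ[ℂ] ℂ)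
  have hf : ∀ a ρ, f a ρ = (ρ.1 : StrongDual ℂ A) a := fun _ _ => rfl
  let K : Set (s → ℂ) := f '' Metric.closedBall (0 : A) 1
  have hK : IsCompact K := by
    let _ : TopologicalSpace A := WeakOp.weakOp
    refine isCompact_weak_closedBall.image_of_continuousOn ?_
    exact continuousOn_pi.2 fun ρ => ρ.1.2
  have hKc : Convex ℝ K :=
    (convex_closedBall (0 : A) 1).is_linear_image (f.restrictScalars ℝ).isLinear
  let v : s → ℂ := fun ρ => l ρ.1
  -- `C • K` is compact and convex. A functional `g` separating `v` from it is given by a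
  -- combination `ρ₀` of the elements of `s`, for which `‖l ρ₀‖` would exceed `C * ‖ρ₀‖`.
  have hv : v ∈ C • K := by
    by_contra hv
    have hcl : IsClosed (C • K) := (hK.smul C).isClosed
    have hcv : Convex ℝ (C • K) := hKc.smul C
    obtain ⟨g, u, hg, hgv⟩ := RCLike.geometric_hahn_banach_closed_point (𝕜 := ℂ) hcv hcl hv
    let ρ₀ : predual A := ∑ ρ : s, g (Pi.single ρ 1) • ρ.1
    have hgf : ∀ w : s → ℂ, g w = ∑ ρ, g (Pi.single ρ 1) * w ρ := by
      intro w
      conv_lhs => rw [pi_eq_sum_univ' w, map_sum]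
      refine Finset.sum_congr rfl fun ρ _ => ?_
      rw [map_smul, smul_eq_mul, mul_comm]
    have h1 : l ρ₀ = g v := by
      rw [hgf]
      simp [ρ₀, v]
    have h2 : ∀ a, (ρ₀ : StrongDual ℂ A) a = g (f a) := by
      intro a
      rw [hgf]
      simp [ρ₀, hf]
    have h3 : C * ‖(ρ₀ : StrongDual ℂ A)‖ ≤ u := by
      refine norm_mul_le_of_re_le hC fun a ha => ?_
      have := hg (C • f a) (Set.smul_mem_smul_set ⟨a, by simpa using ha, rfl⟩)
      rw [← Complex.coe_smul, map_smul, ← h2, smul_eq_mul, RCLike.re_eq_complex_re,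
        Complex.re_ofReal_mul] at this
      exact this.le
    have h4 : RCLike.re (g v) ≤ ‖l ρ₀‖ := by
      rw [h1]
      exact RCLike.re_le_norm _
    linarith [hl ρ₀]
  obtain ⟨_, ⟨a, ha, rfl⟩, hav⟩ := hv
  refine ⟨(C : ℂ) • a, ?_, fun ρ hρ => ?_⟩
  · rw [norm_smul, Complex.norm_real, Real.norm_of_nonneg hC]
    exact mul_le_of_le_one_right hC (by simpa using ha)
  · have := congrFun hav ⟨ρ, hρ⟩
    rw [map_smul]
    exact this.symm

/-- The elements representing `l` on finite sets of functionals lie in one ball; a weak cluster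
point along the directed set of finite sets represents `l` everywhere. -/
theorem isVonNeumann_of_isWStar [IsWStar A] : IsVonNeumann A where
  injective a ha := IsWStar.separating a fun ρ hρ => ha ρ hρ.mem_predual
  surjective l C hC hl := by
    choose f hf1 hf2 using exists_eval_on_finset l hC hl
    obtain ⟨a, ha, hlim⟩ := exists_wlim (Ultrafilter.of (atTop : Filter (Finset (predual A)))) f
      (Eventually.of_forall hf1)
    refine ⟨a, ha, fun ρ => ?_⟩
    have h1 := predual_tendsto ρ.2 (Eventually.of_forall hf1) hlim
    refine tendsto_nhds_unique (tendsto_const_nhds.congr' ?_) h1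
    have h2 : ∀ᶠ s : Finset (predual A) in atTop, l ρ = (ρ : StrongDual ℂ A) (f s) := by
      filter_upwards [eventually_ge_atTop {ρ}] with s hs
      exact hf2 s ρ (hs (Finset.mem_singleton_self ρ))
    exact Ultrafilter.of_le _ h2

end Dual

/-! ### Subalgebras, direct sums and bounded families -/

section Constructions

variable {A B : Type*} [CStarAlgebra A] [WeakOp A] [CStarAlgebra B] [WeakOp B]

theorem tendsto_wnhds_of_induced {S X : Type*} [WeakOp S] [WeakOp X] {i : S → X}
    (h : (WeakOp.weakOp : TopologicalSpace S) = TopologicalSpace.induced i WeakOp.weakOp)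
    {ι : Type*} {l : Filter ι} {f : ι → S} {x : S} :
    Tendsto f l (wnhds x) ↔ Tendsto (fun j => i (f j)) l (wnhds (i x)) := by
  have : wnhds x = comap i (wnhds (i x)) := by
    unfold wnhds
    rw [h, @nhds_induced _ _ WeakOp.weakOp]
  rw [this, tendsto_comap_iff]
  rfl

/-- A weakly closed subspace of `A` inherits the properties of `IsWStar`. -/
theorem isWStar_of_induced {S : Type*} [CStarAlgebra S] [WeakOp S] [IsWStar A] (i : S →ₗ[ℂ] A)
    (hi : ∀ x, ‖i x‖ = ‖x‖)
    (htop : (WeakOp.weakOp : TopologicalSpace S) = TopologicalSpace.induced i WeakOp.weakOp)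
    (hcl : ∀ (u : Ultrafilter S) (a : A), (∀ᶠ x in (u : Filter S), ‖x‖ ≤ 1) →
      Tendsto i u (wnhds a) → a ∈ Set.range i) : IsWStar S := by
  let j : S →L[ℂ] A := i.mkContinuous 1 fun x => by rw [hi, one_mul]
  have hj : ∀ ρ : StrongDual ℂ A, IsWCont ρ → IsWCont (ρ.comp j) := by
    intro ρ hρ x
    exact (hρ (i x)).comp ((tendsto_wnhds_of_induced htop (f := id)).1 tendsto_id)
  refine ⟨fun l a h => ?_, fun a h => ?_, fun u hu => ?_⟩
  · refine (tendsto_wnhds_of_induced htop (f := id)).2 ?_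
    refine IsWStar.le_wnhds _ _ fun ρ hρ => ?_
    rw [tendsto_map'_iff]
    exact h _ (hj ρ hρ)
  · have : i a = 0 := IsWStar.separating _ fun ρ hρ => h _ (hj ρ hρ)
    rw [← norm_eq_zero, ← hi, this, norm_zero]
  · have hu' : ∀ᶠ x in (u : Filter S), ‖i x‖ ≤ 1 := by simpa only [hi] using hu
    obtain ⟨a, ha, h⟩ := exists_wlim u i hu'
    obtain ⟨x, rfl⟩ := hcl u a hu h
    exact ⟨x, by rwa [hi] at ha, (tendsto_wnhds_of_induced htop (f := id)).2 h⟩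

theorem SubCStar.tendsto_wnhds {S : SubCStar A} {ι : Type*} {l : Filter ι} {f : ι → S} {x : S} :
    Tendsto f l (wnhds x) ↔ Tendsto (fun j => S.incl (f j)) l (wnhds (S.incl x)) :=
  tendsto_wnhds_of_induced rfl

theorem StarSubalgebra.tendsto_wnhds {S : StarSubalgebra ℂ A} {ι : Type*} {l : Filter ι}
    {f : ι → S} {x : S} :
    Tendsto f l (wnhds x) ↔ Tendsto (fun j => (f j : A)) l (wnhds (x : A)) :=
  tendsto_wnhds_of_induced rfl

theorem SubCStar.isWStar [IsWStar A] (S : SubCStar A)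
    (hcl : ∀ (u : Ultrafilter S) (a : A), (∀ᶠ x in (u : Filter S), ‖x‖ ≤ 1) →
      Tendsto S.incl u (wnhds a) → a ∈ S.carrier) : IsWStar S :=
  isWStar_of_induced S.incl (fun _ => rfl) rfl fun u a h1 h2 => ⟨⟨a, hcl u a h1 h2⟩, rfl⟩

theorem StarSubalgebra.isWStar [IsWStar A] (S : StarSubalgebra ℂ A) [IsClosed (S : Set A)]
    (hcl : ∀ (u : Ultrafilter S) (a : A), (∀ᶠ x in (u : Filter S), ‖x‖ ≤ 1) →
      Tendsto (fun x : S => (x : A)) u (wnhds a) → a ∈ S) : IsWStar S :=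
  isWStar_of_induced S.toSubalgebra.val.toLinearMap (fun _ => rfl) rfl
    fun u a h1 h2 => ⟨⟨a, hcl u a h1 h2⟩, rfl⟩

theorem Prod.tendsto_wnhds {ι X Y : Type*} [WeakOp X] [WeakOp Y] {l : Filter ι} {f : ι → X × Y}
    {x : X × Y} :
    Tendsto f l (wnhds x) ↔
      Tendsto (fun j => (f j).1) l (wnhds x.1) ∧ Tendsto (fun j => (f j).2) l (wnhds x.2) := by
  let _ : TopologicalSpace X := WeakOp.weakOp
  let _ : TopologicalSpace Y := WeakOp.weakOp
  exact Prod.tendsto_iff f x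

instance [IsWStar A] [IsWStar B] : IsWStar (A × B) where
  le_wnhds l x h := by
    refine Prod.tendsto_wnhds (f := id).2 ⟨?_, ?_⟩
    · refine IsWStar.le_wnhds _ _ fun ρ hρ => ?_
      rw [tendsto_map'_iff]
      exact h (ρ.comp (ContinuousLinearMap.fst ℂ A B))
        fun y => (hρ y.1).comp (Prod.tendsto_wnhds (f := id).1 tendsto_id).1
    · refine IsWStar.le_wnhds _ _ fun ρ hρ => ?_
      rw [tendsto_map'_iff]
      exact h (ρ.comp (ContinuousLinearMap.snd ℂ A B))
        fun y => (hρ y.2).comp (Prod.tendsto_wnhds (f := id).1 tendsto_id).2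
  separating x h := by
    refine Prod.ext ?_ ?_
    · exact IsWStar.separating _ fun ρ hρ => h (ρ.comp (ContinuousLinearMap.fst ℂ A B))
        fun y => (hρ y.1).comp (Prod.tendsto_wnhds (f := id).1 tendsto_id).1
    · exact IsWStar.separating _ fun ρ hρ => h (ρ.comp (ContinuousLinearMap.snd ℂ A B))
        fun y => (hρ y.2).comp (Prod.tendsto_wnhds (f := id).1 tendsto_id).2
  compact u hu := by
    obtain ⟨a, ha, h1⟩ := exists_wlim u Prod.fst (hu.mono fun x hx => (norm_fst_le x).trans hx)
    obtain ⟨b, hb, h2⟩ := exists_wlim u Prod.snd (hu.mono fun x hx => (norm_snd_le x).trans hx)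
    exact ⟨(a, b), max_le ha hb, Prod.tendsto_wnhds (f := id).2 ⟨h1, h2⟩⟩

variable {I : Type*} [TopologicalSpace I]

theorem BoundedContinuousFunction.tendsto_wnhds {ι : Type*} {l : Filter ι}
    {f : ι → I →ᵇ A} {x : I →ᵇ A} :
    Tendsto f l (wnhds x) ↔ ∀ i, Tendsto (fun j => f j i) l (wnhds (x i)) := by
  let _ : TopologicalSpace A := WeakOp.weakOp
  have : wnhds x = comap (fun (f : I →ᵇ A) (i : I) => f i) (𝓝 (fun i => x i)) := nhds_induced _ _
  rw [this, tendsto_comap_iff, tendsto_pi_nhds]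
  rfl

/-- Compactness is Tychonoff's theorem: the coordinatewise limits obey a common bound, and
discreteness of `I` makes every bounded family a bounded continuous function. -/
instance [DiscreteTopology I] [IsWStar A] : IsWStar (I →ᵇ A) where
  le_wnhds l x h := by
    refine BoundedContinuousFunction.tendsto_wnhds (f := id).2 fun i => ?_
    refine IsWStar.le_wnhds _ _ fun ρ hρ => ?_
    rw [tendsto_map'_iff]
    exact h (ρ.comp (BoundedContinuousFunction.evalCLM ℂ i))
      fun y => (hρ (y i)).comp (BoundedContinuousFunction.tendsto_wnhds (f := id).1 tendsto_id i)
  separating x h := by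
    ext i
    exact IsWStar.separating _ fun ρ hρ => h (ρ.comp (BoundedContinuousFunction.evalCLM ℂ i))
      fun y => (hρ (y i)).comp (BoundedContinuousFunction.tendsto_wnhds (f := id).1 tendsto_id i)
  compact u hu := by
    have h1 : ∀ i, ∃ a : A, ‖a‖ ≤ 1 ∧ Tendsto (fun f : I →ᵇ A => f i) u (wnhds a) := fun i =>
      exists_wlim u _ (hu.mono fun x hx => (x.norm_coe_le_norm i).trans hx)
    choose g hg1 hg2 using h1
    refine ⟨BoundedContinuousFunction.ofNormedAddCommGroupDiscrete g 1 hg1, ?_, ?_⟩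
    · exact (BoundedContinuousFunction.norm_le zero_le_one).2 hg1
    · exact BoundedContinuousFunction.tendsto_wnhds (f := id).2 hg2

end Constructions

/-! ### Von Neumann algebras of operators -/

section Operators

variable {H : Type*} [NormedAddCommGroup H] [InnerProductSpace ℂ H] [CompleteSpace H]

theorem operator_tendsto_wnhds {ι : Type*} {l : Filter ι} {f : ι → H →L[ℂ] H} {T : H →L[ℂ] H} :
    Tendsto f l (wnhds T) ↔
      ∀ x y, Tendsto (fun j => inner ℂ y (f j x)) l (𝓝 (inner ℂ y (T x))) := by
  have : wnhds T = comap (fun T => (ContinuousLinearMapWOT.ofCLM T : H →WOT[ℂ] H))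
    (𝓝 (ContinuousLinearMapWOT.ofCLM T)) := nhds_induced _ _
  rw [this, tendsto_comap_iff, ContinuousLinearMapWOT.tendsto_iff_forall_inner_apply_tendsto]
  rfl

theorem operator_tendsto_wnhds_left {ι : Type*} {l : Filter ι} {f : ι → H →L[ℂ] H}
    {T : H →L[ℂ] H} (h : ∀ x y, Tendsto (fun j => inner ℂ (f j x) y) l (𝓝 (inner ℂ (T x) y))) :
    Tendsto f l (wnhds T) := by
  refine operator_tendsto_wnhds.2 fun x y => ?_
  simpa only [Function.comp_def, inner_conj_symm] using
    ((Complex.continuous_conj.tendsto _).comp (h x y))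

theorem operator_mul_left (T S : H →L[ℂ] H) :
    Tendsto (fun x => S * x) (wnhds T) (wnhds (S * T)) := by
  refine operator_tendsto_wnhds.2 fun x y => ?_
  have := operator_tendsto_wnhds.1 (tendsto_id : Tendsto id (wnhds T) (wnhds T)) x
    (ContinuousLinearMap.adjoint S y)
  simpa [ContinuousLinearMap.adjoint_inner_left] using this

theorem operator_mul_right (T S : H →L[ℂ] H) :
    Tendsto (fun x => x * S) (wnhds T) (wnhds (T * S)) := by
  refine operator_tendsto_wnhds.2 fun x y => ?_
  exact operator_tendsto_wnhds.1 (tendsto_id : Tendsto id (wnhds T) (wnhds T)) (S x) y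

theorem operator_star (T : H →L[ℂ] H) :
    Tendsto (fun x => star x) (wnhds T) (wnhds (star T)) := by
  refine operator_tendsto_wnhds_left fun x y => ?_
  have := operator_tendsto_wnhds.1 (tendsto_id : Tendsto id (wnhds T) (wnhds T)) y x
  simpa [ContinuousLinearMap.star_eq_adjoint, ContinuousLinearMap.adjoint_inner_left] using this

theorem operator_wlim_unique {ι : Type*} {l : Filter ι} [l.NeBot] {f : ι → H →L[ℂ] H}
    {S T : H →L[ℂ] H} (hS : Tendsto f l (wnhds S)) (hT : Tendsto f l (wnhds T)) : S = T := by
  ext x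
  refine ext_inner_left ℂ fun y => ?_
  exact tendsto_nhds_unique (operator_tendsto_wnhds.1 hS x y) (operator_tendsto_wnhds.1 hT x y)

/-- The unit ball of `B(H)` is compact in the weak operator topology. -/
theorem operator_exists_wlim {ι : Type*} (u : Ultrafilter ι) (f : ι → H →L[ℂ] H)
    (hu : ∀ᶠ i in (u : Filter ι), ‖f i‖ ≤ 1) :
    ∃ T : H →L[ℂ] H, ‖T‖ ≤ 1 ∧ Tendsto f u (wnhds T) := by
  have h1 : ∀ x y : H, ∃ z : ℂ, ‖z‖ ≤ 1 * ‖x‖ * ‖y‖ ∧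
      Tendsto (fun i => inner ℂ (f i x) y) u (𝓝 z) := by
    intro x y
    have h2 : ∀ᶠ i in (u : Filter ι),
        inner ℂ (f i x) y ∈ Metric.closedBall (0 : ℂ) (1 * ‖x‖ * ‖y‖) := by
      filter_upwards [hu] with i hi
      rw [mem_closedBall_zero_iff]
      refine (norm_inner_le_norm _ _).trans ?_
      gcongr
      exact ((f i).le_opNorm x).trans (by gcongr)
    obtain ⟨z, hz, h⟩ := isCompact_iff_ultrafilter_le_nhds.1
      (isCompact_closedBall (0 : ℂ) (1 * ‖x‖ * ‖y‖)) (u.map fun i => inner ℂ (f i x) y)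
      (le_principal_iff.2 h2)
    exact ⟨z, by simpa using hz, h⟩
  choose b hb1 hb2 using h1
  -- Pointwise limits of sesquilinear forms of norm at most 1 are again such forms; Riesz
  -- representation then gives the limit operator.
  let B : H →L⋆[ℂ] H →L[ℂ] ℂ := (LinearMap.mk₂'ₛₗ (starRingEnd ℂ) (RingHom.id ℂ) b
    (fun x x' y => tendsto_nhds_unique (hb2 _ _)
      (by simpa [inner_add_left] using (hb2 x y).add (hb2 x' y)))
    (fun c x y => tendsto_nhds_unique (hb2 _ _)
      (by simpa [inner_smul_left, mul_comm] using (hb2 x y).const_mul (starRingEnd ℂ c)))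
    (fun x y y' => tendsto_nhds_unique (hb2 _ _)
      (by simpa [inner_add_right] using (hb2 x y).add (hb2 x y')))
    (fun c x y => tendsto_nhds_unique (hb2 _ _)
      (by simpa [inner_smul_right] using (hb2 x y).const_mul c))).mkContinuous₂ 1 hb1
  let T := InnerProductSpace.continuousLinearMapOfBilin B
  have hT : ∀ x y, inner ℂ (T x) y = b x y :=
    fun x y => InnerProductSpace.continuousLinearMapOfBilin_apply B x y
  refine ⟨T, ?_, operator_tendsto_wnhds_left fun x y => by rw [hT]; exact hb2 x y⟩
  refine T.opNorm_le_bound zero_le_one fun x => ?_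
  rcases (norm_nonneg (T x)).eq_or_lt with h | h
  · rw [← h]
    positivity
  · refine le_of_mul_le_mul_right ?_ h
    have := hb1 x (T x)
    rwa [← hT, inner_self_eq_norm_sq_to_K, norm_pow, RCLike.norm_ofReal, abs_norm, sq] at this

variable (N : VonNeumannAlgebra H)

theorem VonNeumannAlgebra.tendsto_wnhds {ι : Type*} {l : Filter ι} {f : ι → N.toStarSubalgebra}
    {x : N.toStarSubalgebra} : Tendsto f l (wnhds x) ↔
      Tendsto (fun j => (f j : H →L[ℂ] H)) l (wnhds (x : H →L[ℂ] H)) :=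
  tendsto_wnhds_of_induced rfl

/-- The vector functional `T ↦ ⟨y, T x⟩`. -/
def vectorFunctional (x y : H) : StrongDual ℂ N.toStarSubalgebra :=
  (innerSL ℂ y).comp ((ContinuousLinearMap.apply ℂ H x).comp
    (N.toStarSubalgebra.toSubalgebra.toSubmodule.subtypeL))

theorem vectorFunctional_apply (x y : H) (a : N.toStarSubalgebra) :
    vectorFunctional N x y a = inner ℂ y ((a : H →L[ℂ] H) x) := rfl

theorem isWCont_vectorFunctional (x y : H) : IsWCont (vectorFunctional N x y) := by
  intro a
  have h := (VonNeumannAlgebra.tendsto_wnhds N).1 (tendsto_id : Tendsto id (wnhds a) (wnhds a))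
  exact operator_tendsto_wnhds.1 h x y

instance : IsWAlg N.toStarSubalgebra where
  le_wnhds l a h := by
    refine (VonNeumannAlgebra.tendsto_wnhds N (f := id)).2 (operator_tendsto_wnhds.2 fun x y => ?_)
    exact h _ (isWCont_vectorFunctional N x y)
  separating a h := by
    refine Subtype.ext (ContinuousLinearMap.ext fun x => ext_inner_left ℂ fun y => ?_)
    simpa [vectorFunctional_apply] using h _ (isWCont_vectorFunctional N x y)
  compact u hu := by
    obtain ⟨T, hT, h⟩ := operator_exists_wlim u (fun x => (x : H →L[ℂ] H)) hu
    -- By the bicommutant property it is enough that commuting with a fixed operator survives weak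
    -- limits.
    have hmem : T ∈ N.toStarSubalgebra := by
      rw [VonNeumannAlgebra.mem_carrier, ← N.centralizer_centralizer, Set.mem_centralizer_iff]
      intro z hz
      have h1 := (operator_mul_left T z).comp h
      have h2 := (operator_mul_right T z).comp h
      refine operator_wlim_unique h1 (h2.congr fun x => ?_)
      exact Set.mem_centralizer_iff.1 hz x x.2
    exact ⟨⟨T, hmem⟩, hT, (VonNeumannAlgebra.tendsto_wnhds N (f := id)).2 h⟩
  mul_left a b := (VonNeumannAlgebra.tendsto_wnhds N).2 ((operator_mul_left _ _).comp
    ((VonNeumannAlgebra.tendsto_wnhds N).1 (tendsto_id : Tendsto id (wnhds a) (wnhds a))))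
  mul_right a b := (VonNeumannAlgebra.tendsto_wnhds N).2 ((operator_mul_right _ _).comp
    ((VonNeumannAlgebra.tendsto_wnhds N).1 (tendsto_id : Tendsto id (wnhds a) (wnhds a))))
  star a := (VonNeumannAlgebra.tendsto_wnhds N).2 ((operator_star _).comp
    ((VonNeumannAlgebra.tendsto_wnhds N).1 (tendsto_id : Tendsto id (wnhds a) (wnhds a))))

end Operators

/-! ### The tail algebra is weakly closed -/

section Range

/-- Elements of the range of a `*`-homomorphism have preimages of controlled norm. -/
theorem exists_preimage_norm_le {A B : Type*} [CStarAlgebra A] [CStarAlgebra B] (φ : A →⋆ₐ[ℂ] B)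
    (a : A) : ∃ a' : A, φ a' = φ a ∧ ‖a'‖ ≤ 2 * ‖φ a‖ := by
  have hsa : ∀ a : A, IsSelfAdjoint a → ∃ a' : A, φ a' = φ a ∧ ‖a'‖ ≤ ‖φ a‖ := by
    intro a ha
    -- Truncation at height `‖φ a‖` is the identity on the spectrum of `φ a`, so it shortens `a`
    -- without changing its image. The factor 2 comes from treating real and imaginary parts
    -- separately.
    let f : ℝ → ℝ := fun t => max (-‖φ a‖) (min t ‖φ a‖)
    have hf : Continuous f := by fun_prop
    have hb : IsSelfAdjoint (φ a) := ha.map φ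
    refine ⟨cfc f a, ?_, ?_⟩
    · have hφ : Continuous φ := map_continuous φ
      rw [StarAlgHomClass.map_cfc φ f a]
      conv_rhs => rw [← cfc_id ℝ (φ a)]
      refine cfc_congr fun t ht => ?_
      have : Nontrivial B := by
        by_contra hB
        rw [not_nontrivial_iff_subsingleton] at hB
        simp [spectrum.of_subsingleton] at ht
      have h1 : ‖t‖ ≤ ‖φ a‖ := spectrum.norm_le_norm_of_mem ht
      rw [Real.norm_eq_abs, abs_le] at h1
      simp [f, h1.1, h1.2]
    · refine norm_cfc_le (norm_nonneg _) fun t _ => ?_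
      rw [Real.norm_eq_abs, abs_le]
      exact ⟨le_max_left _ _, max_le (by linarith [norm_nonneg (φ a)]) (min_le_right _ _)⟩
  have hre : φ (realPart a : A) = (realPart (φ a) : B) := by
    rw [realPart_apply_coe, realPart_apply_coe, ← map_star, ← map_add]
    exact map_real_smul φ (map_continuous φ) _ _
  have him : φ (imaginaryPart a : A) = (imaginaryPart (φ a) : B) := by
    rw [imaginaryPart_apply_coe, imaginaryPart_apply_coe, ← map_star, ← map_sub, map_smul]
    exact congrArg _ (map_real_smul φ (map_continuous φ) _ _)
  obtain ⟨x, hx, hx'⟩ := hsa (realPart a) (realPart a).2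
  obtain ⟨y, hy, hy'⟩ := hsa (imaginaryPart a) (imaginaryPart a).2
  refine ⟨x + Complex.I • y, ?_, ?_⟩
  · rw [map_add, map_smul, hx, hy, ← map_smul, ← map_add, realPart_add_I_smul_imaginaryPart]
  · rw [hre] at hx'
    rw [him] at hy'
    calc ‖x + Complex.I • y‖ ≤ ‖x‖ + ‖Complex.I • y‖ := norm_add_le _ _
      _ = ‖x‖ + ‖y‖ := by rw [norm_smul, Complex.norm_I, one_mul]
      _ ≤ ‖φ a‖ + ‖φ a‖ :=
        add_le_add (hx'.trans (realPart.norm_le (φ a))) (hy'.trans (imaginaryPart.norm_le (φ a)))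
      _ = 2 * ‖φ a‖ := by ring

/-- The range of a normal `*`-homomorphism contains the weak limits of its bounded nets. -/
theorem mem_range_of_wlim {A B : Type*} [CStarAlgebra A] [WeakOp A] [CStarAlgebra B] [WeakOp B]
    [IsWStar A] [IsWStar B] {φ : A →⋆ₐ[ℂ] B} (hφ : IsNormalMap φ) {ι : Type*} {l : Filter ι}
    [l.NeBot] {f : ι → B} {b : B} {C : ℝ} (hf : ∀ᶠ i in l, ‖f i‖ ≤ C)
    (hr : ∀ᶠ i in l, ∃ a, φ a = f i) (hb : Tendsto f l (wnhds b)) : ∃ a, φ a = b := by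
  -- Preimages of controlled norm form a bounded net, whose cluster points map to `b`; the value 0
  -- off the range is never used.
  have h1 : ∀ y : B, ∃ a : A, (∃ a', φ a' = y) → φ a = y ∧ ‖a‖ ≤ 2 * ‖y‖ := by
    intro y
    by_cases h : ∃ a', φ a' = y
    · obtain ⟨a', rfl⟩ := h
      obtain ⟨a, h1, h2⟩ := exists_preimage_norm_le φ a'
      exact ⟨a, fun _ => ⟨h1, h2⟩⟩
    · exact ⟨0, fun h' => absurd h' h⟩
  choose g hg using h1
  let u := Ultrafilter.of l
  have hu : (u : Filter ι) ≤ l := Ultrafilter.of_le l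
  have hgb : ∀ᶠ i in (u : Filter ι), ‖g (f i)‖ ≤ 2 * C := by
    filter_upwards [hu hf, hu hr] with i h1 h2
    have h1 : ‖f i‖ ≤ C := h1
    linarith [(hg (f i) h2).2]
  obtain ⟨a, _, ha⟩ := exists_wlim u (fun i => g (f i)) hgb
  refine ⟨a, wlim_unique ((isWMap_of_isNormalMap hφ).tendsto hgb ha) (Tendsto.congr' ?_
    (hb.mono_left hu))⟩
  filter_upwards [hu hr] with i hi
  exact (hg (f i) hi).1.symm

end Range

section TailAlgebra

variable {A : Type*} [CStarAlgebra A] {α : A →⋆ₐ[ℂ] A}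

theorem mem_tail {x : A} : x ∈ tail α ↔ ∀ n : ℕ, ∃ y, (α ^ n) y = x := by
  rw [tail, StarSubalgebra.mem_iInf]
  rfl

theorem pow_succ_apply (α : A →⋆ₐ[ℂ] A) (n : ℕ) (x : A) : (α ^ (n + 1)) x = (α ^ n) (α x) := by
  rw [pow_succ]
  rfl

theorem pow_succ_apply' (α : A →⋆ₐ[ℂ] A) (n : ℕ) (x : A) : (α ^ (n + 1)) x = α ((α ^ n) x) := by
  rw [pow_succ']
  rfl

theorem pow_add_apply (α : A →⋆ₐ[ℂ] A) (m n : ℕ) (x : A) :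
    (α ^ (m + n)) x = (α ^ m) ((α ^ n) x) := by
  rw [pow_add]
  rfl

theorem map_mem_tail {x : A} (hx : x ∈ tail α) : α x ∈ tail α := by
  rw [mem_tail] at hx ⊢
  intro n
  obtain ⟨y, rfl⟩ := hx n
  exact ⟨α y, by rw [← pow_succ_apply, pow_succ_apply']⟩

theorem pow_mem_tail {x : A} (hx : x ∈ tail α) (n : ℕ) : (α ^ n) x ∈ tail α := by
  induction n with
  | zero => exact hx
  | succ n ih =>
    rw [pow_succ_apply']
    exact map_mem_tail ih

variable [WeakOp A] [IsWStar A]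

/-- Membership in each range is required only eventually, so that limits of `α^m(x_m)` are covered
even if no term lies in the tail algebra. -/
theorem mem_tail_of_wlim (hα : IsNormalMap α) {ι : Type*} {l : Filter ι} [l.NeBot] {f : ι → A}
    {a : A} {C : ℝ} (hf : ∀ᶠ i in l, ‖f i‖ ≤ C)
    (hr : ∀ n : ℕ, ∀ᶠ i in l, ∃ y, (α ^ n) y = f i) (ha : Tendsto f l (wnhds a)) : a ∈ tail α :=
  mem_tail.2 fun n => mem_range_of_wlim (isNormalMap_pow hα n) hf (hr n) ha

theorem mem_tail_of_wlim' (hα : IsNormalMap α) {ι : Type*} {l : Filter ι} [l.NeBot] {f : ι → A}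
    {a : A} {C : ℝ} (hf : ∀ᶠ i in l, ‖f i‖ ≤ C) (hr : ∀ᶠ i in l, f i ∈ tail α)
    (ha : Tendsto f l (wnhds a)) : a ∈ tail α :=
  mem_tail_of_wlim hα hf (fun n => hr.mono fun _ hi => mem_tail.1 hi n) ha

theorem isWStar_tail (hα : IsNormalMap α) : IsWStar (tail α) :=
  StarSubalgebra.isWStar _ fun _ _ hu h =>
    mem_tail_of_wlim' hα hu (Eventually.of_forall fun x => x.2) h

/-- A normal endomorphism maps its tail algebra onto itself. -/
theorem exists_tail_preimage (hα : IsNormalMap α) {t : A} (ht : t ∈ tail α) :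
    ∃ s ∈ tail α, α s = t := by
  -- An arbitrary preimage of `t` need not lie in the tail algebra. The elements `α^n(x_n)` are
  -- preimages of `t` lying ever deeper in the filtration, so their cluster points do.
  have h1 : ∀ n : ℕ, ∃ x, (α ^ (n + 1)) x = t ∧ ‖x‖ ≤ 2 * ‖t‖ := by
    intro n
    obtain ⟨y, rfl⟩ := mem_tail.1 ht (n + 1)
    exact exists_preimage_norm_le _ y
  choose x hx1 hx2 using h1
  have hb : ∀ n, ‖(α ^ n) (x n)‖ ≤ 2 * ‖t‖ := fun n =>
    (NonUnitalStarAlgHom.norm_apply_le (α ^ n) (x n)).trans (hx2 n)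
  let u := Ultrafilter.of (atTop : Filter ℕ)
  obtain ⟨s, _, hs⟩ := exists_wlim u (fun n => (α ^ n) (x n)) (Eventually.of_forall hb)
  refine ⟨s, mem_tail_of_wlim hα (Eventually.of_forall hb) (fun n => ?_) hs, ?_⟩
  · refine Ultrafilter.of_le (atTop : Filter ℕ) ?_
    filter_upwards [eventually_ge_atTop n] with m hm
    obtain ⟨k, rfl⟩ := Nat.exists_eq_add_of_le hm
    exact ⟨_, (pow_add_apply α n k _).symm⟩
  · have h2 := (isWMap_of_isNormalMap hα).tendsto (Eventually.of_forall hb) hs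
    refine wlim_unique h2 ((wnhds_const t).congr fun n => ?_)
    rw [← pow_succ_apply', hx1]

theorem exists_tail_preimage_pow (hα : IsNormalMap α) (n : ℕ) {t : A} (ht : t ∈ tail α) :
    ∃ s ∈ tail α, (α ^ n) s = t := by
  induction n generalizing t with
  | zero => exact ⟨t, ht, rfl⟩
  | succ n ih =>
    obtain ⟨s, hs, rfl⟩ := exists_tail_preimage hα ht
    obtain ⟨r, hr, rfl⟩ := ih hs
    exact ⟨r, hr, pow_succ_apply' α n r⟩

end TailAlgebra

/-! ### Units of weakly closed ideals -/

section IdealUnit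

variable {A : Type*} [CStarAlgebra A] [WeakOp A] [IsWAlg A]

/-- A weakly closed self-adjoint subalgebra has a unit. -/
theorem exists_unit_of_weakly_closed (J : NonUnitalStarSubalgebra ℂ A)
    [IsClosed (J : Set A)]
    (hcl : ∀ (u : Ultrafilter J) (a : A), (∀ᶠ x in (u : Filter J), ‖x‖ ≤ 1) →
      Tendsto (fun x : J => (x : A)) u (wnhds a) → a ∈ J) :
    ∃ e ∈ J, IsStarProjection e ∧ ∀ x ∈ J, e * x = x ∧ x * e = x := by
  let _ : PartialOrder J := CStarAlgebra.spectralOrder J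
  have _ : StarOrderedRing J := CStarAlgebra.spectralOrderedRing J
  have hau := CStarAlgebra.increasingApproximateUnit J
  -- The unit is a weak cluster point of an approximate unit.
  let u := Ultrafilter.of (CStarAlgebra.approximateUnit J)
  have hu : (u : Filter J) ≤ CStarAlgebra.approximateUnit J := Ultrafilter.of_le _
  have hun : ∀ᶠ x in (u : Filter J), ‖x‖ ≤ 1 := hu hau.eventually_norm
  obtain ⟨e, _, he⟩ := exists_wlim u (fun x : J => (x : A)) hun
  have heJ := hcl u e hun he
  have hval : Continuous (fun x : J => (x : A)) := continuous_subtype_val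
  have hleft : ∀ x ∈ J, e * x = x := by
    intro x hx
    have h1 := (IsWAlg.mul_right e x).comp he
    have h2 : Tendsto (fun y : J => (y : A) * x) u (𝓝 x) :=
      (hval.tendsto _).comp ((hau.tendsto_mul_right ⟨x, hx⟩).mono_left hu)
    exact wlim_unique h1 (wnhds_of_tendsto h2)
  have hright : ∀ x ∈ J, x * e = x := by
    intro x hx
    have h1 := (IsWAlg.mul_left e x).comp he
    have h2 : Tendsto (fun y : J => x * (y : A)) u (𝓝 x) :=
      (hval.tendsto _).comp ((hau.tendsto_mul_left ⟨x, hx⟩).mono_left hu)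
    exact wlim_unique h1 (wnhds_of_tendsto h2)
  refine ⟨e, heJ, ⟨hleft e heJ, ?_⟩, fun x hx => ⟨hleft x hx, hright x hx⟩⟩
  -- From `e e* = e*`, taking adjoints gives `e e* = e`, so `e` is self-adjoint.
  have h1 := hleft (star e) (star_mem heJ)
  have h2 := congrArg star h1
  rw [star_mul, star_star, h1] at h2
  exact h2

end IdealUnit

/-! ### The kernel projections -/

section KernelUnits

variable {A : Type*} [CStarAlgebra A]

/-- `e n` is the unit of the ideal `ker α^n` of the tail algebra. -/
structure IsKernelUnits (α : A →⋆ₐ[ℂ] A) (e : ℕ → A) : Prop where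
  proj : ∀ n, IsStarProjection (e n)
  mem : ∀ n, e n ∈ tail α
  central : ∀ n, ∀ x ∈ tail α, e n * x = x * e n
  map_eq_zero : ∀ n, (α ^ n) (e n) = 0
  mul_eq : ∀ n, ∀ x ∈ tail α, (α ^ n) x = 0 → e n * x = x

/-- This makes the facts about kernel units available for an arbitrary choice of kernel projections,
not only for the one constructed below. -/
theorem KernelProjections.isKernelUnits [WeakOp A] {α : A →⋆ₐ[ℂ] A} (k : KernelProjections α) :
    IsKernelUnits α k.cn where
  proj := k.cn_proj
  mem := k.cn_mem
  central := k.cn_central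
  map_eq_zero n := (k.cn_ker n _ (k.cn_mem n)).2 ⟨1, one_mem _, (mul_one _).symm⟩
  mul_eq n x hx h := by
    obtain ⟨y, _, rfl⟩ := (k.cn_ker n x hx).1 h
    rw [← mul_assoc, (k.cn_proj n).isIdempotentElem.eq]

namespace IsKernelUnits

variable {α : A →⋆ₐ[ℂ] A} {e : ℕ → A}

theorem mul_of_le (h : IsKernelUnits α e) {m n : ℕ} (hmn : m ≤ n) : e n * e m = e m := by
  refine h.mul_eq n _ (h.mem m) ?_
  obtain ⟨k, rfl⟩ := Nat.exists_eq_add_of_le' hmn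
  rw [pow_add_apply, h.map_eq_zero, map_zero]

theorem mul_of_le' (h : IsKernelUnits α e) {m n : ℕ} (hmn : m ≤ n) : e m * e n = e m := by
  rw [h.central m _ (h.mem n), h.mul_of_le hmn]

theorem zero (h : IsKernelUnits α e) : e 0 = 0 := h.map_eq_zero 0

theorem norm_le (h : IsKernelUnits α e) (n : ℕ) : ‖e n‖ ≤ 1 := IsStarProjection.norm_le _ (h.proj n)

/-- The image of `e (n + 1)` is killed by `α^n`, hence lies under `e n`. Conversely `e n = α s` with
`s` in the tail algebra; then `s` is killed by `α^(n+1)`, so `e (n + 1) * s = s`, and applying `α`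
shows that the image lies above `e n`. -/
theorem map_succ (h : IsKernelUnits α e) [WeakOp A] [IsWStar A] (hα : IsNormalMap α) (n : ℕ) :
    α (e (n + 1)) = e n := by
  have h1 : α (e (n + 1)) ∈ tail α := map_mem_tail (h.mem _)
  have h2 : (α ^ n) (α (e (n + 1))) = 0 := by rw [← pow_succ_apply, h.map_eq_zero]
  have h3 := h.mul_eq n _ h1 h2
  obtain ⟨s, hs, hsn⟩ := exists_tail_preimage hα (h.mem n)
  have h4 : (α ^ (n + 1)) s = 0 := by rw [pow_succ_apply, hsn, h.map_eq_zero]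
  have h5 := congrArg α (h.mul_eq (n + 1) s hs h4)
  rw [map_mul, hsn] at h5
  rw [← h3, h.central n _ h1, h5]

theorem map_pow (h : IsKernelUnits α e) [WeakOp A] [IsWStar A] (hα : IsNormalMap α) (n m : ℕ) :
    (α ^ n) (e (m + n)) = e m := by
  induction n with
  | zero => rfl
  | succ n ih => rw [pow_succ_apply, ← add_assoc, h.map_succ hα, ih]

end IsKernelUnits

variable [WeakOp A] [IsWAlg A] {α : A →⋆ₐ[ℂ] A}

/-- The ideal `ker α^n` of the tail algebra. -/
def kerTail (α : A →⋆ₐ[ℂ] A) (n : ℕ) : NonUnitalStarSubalgebra ℂ A where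
  carrier := {x | x ∈ tail α ∧ (α ^ n) x = 0}
  add_mem' hx hy := ⟨add_mem hx.1 hy.1, by rw [map_add, hx.2, hy.2, add_zero]⟩
  zero_mem' := ⟨zero_mem _, map_zero _⟩
  mul_mem' hx hy := ⟨mul_mem hx.1 hy.1, by rw [map_mul, hx.2, zero_mul]⟩
  smul_mem' r x hx := ⟨SMulMemClass.smul_mem r hx.1, by rw [map_smul, hx.2, smul_zero]⟩
  star_mem' hx := ⟨star_mem hx.1, by rw [map_star, hx.2, star_zero]⟩

theorem exists_isKernelUnits (hα : IsNormalMap α) : ∃ e, IsKernelUnits α e := by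
  have h1 : ∀ n, ∃ e ∈ kerTail α n, IsStarProjection e ∧
      ∀ x ∈ kerTail α n, e * x = x ∧ x * e = x := by
    intro n
    have hcl : IsClosed (kerTail α n : Set A) := (isClosed_tail α).inter
      (isClosed_eq (map_continuous (α ^ n)) continuous_const)
    refine exists_unit_of_weakly_closed _ fun u a hu ha => ⟨?_, ?_⟩
    · exact mem_tail_of_wlim' hα hu (Eventually.of_forall fun x => x.2.1) ha
    · have h2 := (isWMap_of_isNormalMap (isNormalMap_pow hα n)).tendsto hu ha
      exact wlim_unique h2 ((wnhds_const 0).congr fun x => x.2.2.symm)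
  choose e he1 he2 he3 using h1
  refine ⟨e, he2, fun n => (he1 n).1, fun n x hx => ?_, fun n => (he1 n).2,
    fun n x hx h0 => (he3 n x ⟨hx, h0⟩).1⟩
  -- Both `e x` and `x e` lie in the ideal, so each equals `e x e`.
  have h2 : e n * x ∈ kerTail α n :=
    ⟨mul_mem (he1 n).1 hx, by rw [map_mul, (he1 n).2, zero_mul]⟩
  have h3 : x * e n ∈ kerTail α n :=
    ⟨mul_mem hx (he1 n).1, by rw [map_mul, (he1 n).2, mul_zero]⟩
  rw [← (he3 n _ h2).2, mul_assoc, (he3 n _ h3).1]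

/-! ### Convergence of the kernel projections. -/

namespace IsKernelUnits

variable {e : ℕ → A}

theorem mul_wlim (h : IsKernelUnits α e) {u : Filter ℕ} [u.NeBot] (hu : u ≤ atTop) {c : A}
    (hc : Tendsto e u (wnhds c)) (n : ℕ) : e n * c = e n := by
  refine wlim_unique ((IsWAlg.mul_left c (e n)).comp hc) ((wnhds_const (e n)).congr' ?_)
  filter_upwards [hu (eventually_ge_atTop n)] with m hm
  exact (h.mul_of_le' hm).symm

/-- Pass to the limit in `e n * d = e n`. For `c = d` this is idempotence of a cluster point;
exchanging `c` and `d` and taking adjoints gives uniqueness of the cluster point, hence convergence.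
-/
theorem wlim_mul_wlim (h : IsKernelUnits α e) {u v : Filter ℕ} [u.NeBot] [v.NeBot] (hv : v ≤ atTop)
    {c d : A} (hc : Tendsto e u (wnhds c)) (hd : Tendsto e v (wnhds d)) : c * d = c :=
  wlim_unique ((IsWAlg.mul_right c d).comp hc) (hc.congr fun n => (h.mul_wlim hv hd n).symm)

theorem star_wlim (h : IsKernelUnits α e) {u : Filter ℕ} [u.NeBot] {c : A}
    (hc : Tendsto e u (wnhds c)) : star c = c :=
  wlim_unique ((IsWAlg.star c).comp hc)
    (hc.congr fun n => ((h.proj n).isSelfAdjoint.star_eq).symm)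

theorem exists_limit (h : IsKernelUnits α e) :
    ∃ c, IsStarProjection c ∧ Tendsto e atTop (wnhds c) := by
  let u := Ultrafilter.of (atTop : Filter ℕ)
  have hu : (u : Filter ℕ) ≤ atTop := Ultrafilter.of_le _
  obtain ⟨c, _, hc⟩ := exists_wlim u e (Eventually.of_forall h.norm_le)
  refine ⟨c, ⟨h.wlim_mul_wlim hu hc hc, h.star_wlim hc⟩, ?_⟩
  refine tendsto_wnhds_of_ultrafilter (Eventually.of_forall h.norm_le) fun v hv d hd => ?_
  have h1 := h.wlim_mul_wlim hu hd hc
  have h2 := congrArg star (h.wlim_mul_wlim hv hc hd)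
  rw [star_mul, h.star_wlim hc, h.star_wlim hd, h1] at h2
  exact h2

end IsKernelUnits

theorem nonempty_kernelProjections (hα : IsNormalMap α) : Nonempty (KernelProjections α) := by
  obtain ⟨e, he⟩ := exists_isKernelUnits hα
  obtain ⟨c, hc, hlim⟩ := he.exists_limit
  exact ⟨{
    cn := e
    c := c
    cn_proj := he.proj
    cn_mem := he.mem
    cn_central := he.central
    cn_ker := fun n x hx => by
      refine ⟨fun h0 => ⟨x, hx, (he.mul_eq n x hx h0).symm⟩, ?_⟩
      rintro ⟨y, _, rfl⟩
      rw [map_mul, he.map_eq_zero, zero_mul]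
    c_proj := hc
    c_mem := mem_tail_of_wlim' hα (Eventually.of_forall he.norm_le) (Eventually.of_forall he.mem)
      hlim
    c_central := fun x hx => wlim_unique ((IsWAlg.mul_right c x).comp hlim)
      (((IsWAlg.mul_left c x).comp hlim).congr fun n => (he.central n x hx).symm)
    c_fixed := by
      have h1 := (isWMap_of_isNormalMap hα).tendsto (Eventually.of_forall fun n =>
        he.norm_le (n + 1)) (hlim.comp (tendsto_add_atTop_nat 1))
      exact wlim_unique h1 (hlim.congr fun n => (he.map_succ hα n).symm)
    c_limit := hlim }⟩

end KernelUnits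

/-! ### The decomposition of the tail algebra -/

section Decomposition

namespace SubCStar

variable {A : Type*} [CStarAlgebra A] {S : SubCStar A}

theorem incl_injective : Function.Injective S.incl := Subtype.val_injective

theorem incl_mem (x : S) : S.incl x ∈ S.carrier := x.2

end SubCStar

namespace KernelProjections

variable {A : Type*} [CStarAlgebra A] [WeakOp A] {α : A →⋆ₐ[ℂ] A} (k : KernelProjections α)

theorem mem_P {x : A} : x ∈ k.P.carrier ↔ x ∈ tail α ∧ k.c * x = 0 := by
  constructor
  · rintro ⟨y, hy, rfl⟩
    refine ⟨mul_mem (sub_mem (one_mem _) k.c_mem) hy, ?_⟩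
    rw [← mul_assoc, mul_sub, mul_one, k.c_proj.isIdempotentElem.eq, sub_self, zero_mul]
  · rintro ⟨hx, h⟩
    exact ⟨x, hx, by rw [sub_mul, one_mul, h, sub_zero]⟩

theorem mem_K {x : A} : x ∈ k.K.carrier ↔ x ∈ tail α ∧ α x = 0 := Iff.rfl

/-- The restriction of `α` to `P`. -/
def restrictP : k.P →⋆ₙₐ[ℂ] k.P where
  toFun x := ⟨α (k.P.incl x), k.mem_P.2 ⟨map_mem_tail (k.mem_P.1 x.2).1, by
    rw [← k.c_fixed, ← map_mul, show k.c * k.P.incl x = 0 from (k.mem_P.1 x.2).2, map_zero]⟩⟩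
  map_smul' r x := Subtype.ext (map_smul α r (k.P.incl x))
  map_zero' := Subtype.ext (map_zero α)
  map_add' x y := Subtype.ext (map_add α (k.P.incl x) (k.P.incl y))
  map_mul' x y := Subtype.ext (map_mul α (k.P.incl x) (k.P.incl y))
  map_star' x := Subtype.ext (map_star α (k.P.incl x))

theorem cn_one_mul_mem {t : A} (ht : t ∈ tail α) : k.cn 1 * t ∈ k.K.carrier := by
  refine ⟨mul_mem (k.cn_mem 1) ht, ?_⟩
  have : α (k.cn 1) = 0 := by simpa using k.isKernelUnits.map_eq_zero 1
  rw [map_mul, this, zero_mul]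

/-- The map `t ↦ (c₁ α^n(t))_n`. -/
def coords (t : tail α) : ℕ →ᵇ k.K :=
  BoundedContinuousFunction.ofNormedAddCommGroupDiscrete
    (fun n => ⟨k.cn 1 * (α ^ n) (t : A), k.cn_one_mul_mem (pow_mem_tail t.2 n)⟩) ‖t‖ fun n => by
      change ‖k.cn 1 * (α ^ n) (t : A)‖ ≤ _
      refine (norm_mul_le _ _).trans ?_
      refine (mul_le_of_le_one_left (norm_nonneg _) (k.isKernelUnits.norm_le 1)).trans ?_
      exact NonUnitalStarAlgHom.norm_apply_le (α ^ n) (t : A)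

/-- The map `t ↦ ((1 - c) t, (c₁ α^n(t))_n)`. -/
def split : tail α →⋆ₙₐ[ℂ] (k.P × (ℕ →ᵇ k.K)) where
  toFun t := (⟨(1 - k.c) * t, t, t.2, rfl⟩, k.coords t)
  map_smul' r t := by
    refine Prod.ext (Subtype.ext (mul_smul_comm r _ _)) (BoundedContinuousFunction.ext fun n => ?_)
    refine SubCStar.incl_injective ?_
    change k.cn 1 * (α ^ n) (r • (t : A)) = r • (k.cn 1 * (α ^ n) (t : A))
    rw [map_smul, mul_smul_comm]
  map_zero' := by
    refine Prod.ext (Subtype.ext (mul_zero _)) (BoundedContinuousFunction.ext fun n => ?_)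
    refine SubCStar.incl_injective ?_
    change k.cn 1 * (α ^ n) 0 = 0
    rw [map_zero, mul_zero]
  map_add' s t := by
    refine Prod.ext (Subtype.ext (mul_add _ _ _)) (BoundedContinuousFunction.ext fun n => ?_)
    refine SubCStar.incl_injective ?_
    change k.cn 1 * (α ^ n) ((s : A) + t) = k.cn 1 * (α ^ n) s + k.cn 1 * (α ^ n) t
    rw [map_add, mul_add]
  map_mul' s t := by
    refine Prod.ext (Subtype.ext ?_) (BoundedContinuousFunction.ext fun n => ?_)
    · change (1 - k.c) * ((s : A) * t) = (1 - k.c) * s * ((1 - k.c) * t)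
      have h1 : (s : A) * (1 - k.c) = (1 - k.c) * s := by
        rw [mul_sub, sub_mul, mul_one, one_mul, k.c_central s s.2]
      rw [mul_assoc, ← mul_assoc (s : A), h1, mul_assoc, ← mul_assoc (1 - k.c) (1 - k.c),
        k.c_proj.one_sub.isIdempotentElem.eq]
    · refine SubCStar.incl_injective ?_
      change k.cn 1 * (α ^ n) ((s : A) * t) = k.cn 1 * (α ^ n) s * (k.cn 1 * (α ^ n) t)
      rw [map_mul, mul_assoc, ← mul_assoc ((α ^ n) (s : A)),
        ← k.cn_central 1 _ (pow_mem_tail s.2 n), mul_assoc, ← mul_assoc (k.cn 1) (k.cn 1),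
        (k.cn_proj 1).isIdempotentElem.eq]
  map_star' t := by
    refine Prod.ext (Subtype.ext ?_) (BoundedContinuousFunction.ext fun n => ?_)
    · change (1 - k.c) * star (t : A) = star ((1 - k.c) * t)
      rw [star_mul, k.c_proj.one_sub.isSelfAdjoint.star_eq, mul_sub, sub_mul, mul_one, one_mul,
        k.c_central _ (star_mem t.2)]
    · refine SubCStar.incl_injective ?_
      change k.cn 1 * (α ^ n) (star (t : A)) = star (k.cn 1 * (α ^ n) t)
      rw [star_mul, (k.cn_proj 1).isSelfAdjoint.star_eq, map_star,
        k.cn_central 1 _ (star_mem (pow_mem_tail t.2 n))]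

theorem incl_split_fst (t : tail α) : k.P.incl (k.split t).1 = (1 - k.c) * t := rfl

theorem incl_split_snd (t : tail α) (n : ℕ) :
    k.K.incl ((k.split t).2 n) = k.cn 1 * (α ^ n) (t : A) := rfl

variable [IsWAlg A]

theorem isWStar_K (hα : IsNormalMap α) : IsWStar k.K := by
  refine SubCStar.isWStar _ fun u a hu ha => ⟨?_, ?_⟩
  · exact mem_tail_of_wlim' hα hu (Eventually.of_forall fun x => x.2.1) ha
  · exact wlim_unique ((isWMap_of_isNormalMap hα).tendsto hu ha)
      ((wnhds_const 0).congr fun x => x.2.2.symm)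

theorem isWStar_P (hα : IsNormalMap α) : IsWStar k.P := by
  refine SubCStar.isWStar _ fun u a hu ha => k.mem_P.2 ⟨?_, ?_⟩
  · exact mem_tail_of_wlim' hα hu (Eventually.of_forall fun x => (k.mem_P.1 x.2).1) ha
  · exact wlim_unique ((IsWAlg.mul_left a k.c).comp ha)
      ((wnhds_const 0).congr fun x => (k.mem_P.1 x.2).2.symm)

theorem cn_mul_c (n : ℕ) : k.cn n * k.c = k.cn n :=
  k.isKernelUnits.mul_wlim le_rfl k.c_limit n

/-- An element of `P` killed by `α` lies under `c_1 ≤ c`, but `P` is orthogonal to `c`. For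
surjectivity, a preimage in the tail algebra may be cut down by `1 - c`, since `c` is fixed. -/
theorem restrictP_bijective (hα : IsNormalMap α) : Function.Bijective k.restrictP := by
  constructor
  · refine (injective_iff_map_eq_zero k.restrictP).2 fun x hx => ?_
    have h1 : α (k.P.incl x) = 0 := congrArg k.P.incl hx
    obtain ⟨hx1, hx2⟩ := k.mem_P.1 (SubCStar.incl_mem x)
    have h2 := k.isKernelUnits.mul_eq 1 _ hx1 (by simpa using h1)
    rw [← k.cn_mul_c, mul_assoc, hx2, mul_zero] at h2
    exact SubCStar.incl_injective h2.symm
  · intro y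
    obtain ⟨hy1, hy2⟩ := k.mem_P.1 (SubCStar.incl_mem y)
    obtain ⟨s, hs, hsy⟩ := exists_tail_preimage hα hy1
    refine ⟨⟨(1 - k.c) * s, s, hs, rfl⟩, SubCStar.incl_injective ?_⟩
    change α ((1 - k.c) * s) = _
    rw [map_mul, map_sub, map_one, k.c_fixed, hsy, sub_mul, one_mul, hy2, sub_zero]

/-- The automorphism of `P` defined by `α`. -/
def autP (hα : IsNormalMap α) : k.P ≃⋆ₐ[ℂ] k.P :=
  StarAlgEquiv.ofBijective k.restrictP (k.restrictP_bijective hα)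

theorem isWMap_split (hα : IsNormalMap α) : IsWMap k.split := by
  have := isWStar_tail hα
  intro l t C hl _ ht
  have ht' : Tendsto (fun s : tail α => (s : A)) l (wnhds (t : A)) :=
    StarSubalgebra.tendsto_wnhds (f := id).1 ht
  refine Prod.tendsto_wnhds.2 ⟨SubCStar.tendsto_wnhds.2 ?_,
    BoundedContinuousFunction.tendsto_wnhds.2 fun n => SubCStar.tendsto_wnhds.2 ?_⟩
  · exact (IsWAlg.mul_left _ _).comp ht'
  · exact (IsWAlg.mul_left _ _).comp
      ((isWMap_of_isNormalMap (isNormalMap_pow hα n)).tendsto hl ht')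

/-- Because `α^n(c_{n+1}) = c_1`, vanishing of the coordinate `c_1 α^n(t)` puts `c_{n+1} t` in `ker
α^n`, so that `c_{n+1} t = c_n t`. Inductively all `c_n t` vanish, and so does their limit `c t`. -/
theorem split_injective (hα : IsNormalMap α) : Function.Injective k.split := by
  refine (injective_iff_map_eq_zero k.split).2 fun t ht => ?_
  have h1 : (1 - k.c) * (t : A) = 0 := by
    rw [← k.incl_split_fst, ht]
    rfl
  have h2 : ∀ n, k.cn 1 * (α ^ n) (t : A) = 0 := fun n => by
    rw [← k.incl_split_snd, ht]
    rfl
  have h3 : ∀ n, k.cn n * (t : A) = 0 := by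
    intro n
    induction n with
    | zero => rw [k.isKernelUnits.zero, zero_mul]
    | succ n ih =>
      have h4 : (α ^ n) (k.cn (n + 1) * (t : A)) = 0 := by
        rw [map_mul, add_comm, k.isKernelUnits.map_pow hα, h2]
      rw [← k.isKernelUnits.mul_eq n _ (mul_mem (k.cn_mem _) t.2) h4, ← mul_assoc,
        k.isKernelUnits.mul_of_le' n.le_succ, ih]
  have h4 : k.c * (t : A) = 0 := wlim_unique ((IsWAlg.mul_right k.c (t : A)).comp k.c_limit)
    ((wnhds_const 0).congr fun n => (h3 n).symm)
  rw [sub_mul, h4, one_mul, sub_zero] at h1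
  exact Subtype.ext h1

/-- Lift `z` through `α^n` and cut by `c_{n+1} - c_n`. For `m ≤ n`, `α^m` sends this projection to
`c_{n+1-m} - c_{n-m}`, whose product with `c_1` is zero unless `m = n`; for `m > n` it is sent to 0.
-/
theorem exists_split_eq_single (hα : IsNormalMap α) (n : ℕ) (z : k.K) :
    ∃ s, (k.split s).1 = 0 ∧ (k.split s).2 n = z ∧ ∀ m ≠ n, (k.split s).2 m = 0 := by
  have hk := k.isKernelUnits
  obtain ⟨r, hr, hrz⟩ := exists_tail_preimage_pow hα n (k.mem_K.1 (SubCStar.incl_mem z)).1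
  refine ⟨⟨(k.cn (n + 1) - k.cn n) * r, mul_mem (sub_mem (k.cn_mem _) (k.cn_mem _)) hr⟩,
    SubCStar.incl_injective ?_, SubCStar.incl_injective ?_,
    fun m hm => SubCStar.incl_injective ?_⟩
  · rw [incl_split_fst, map_zero]
    have h1 : ∀ m, (1 - k.c) * k.cn m = 0 := fun m => by
      rw [sub_mul, one_mul, k.c_central _ (k.cn_mem m), k.cn_mul_c, sub_self]
    rw [← mul_assoc, mul_sub, h1, h1, sub_zero, zero_mul]
  · rw [incl_split_snd, map_mul, map_sub, hrz, hk.map_eq_zero, sub_zero, add_comm n 1,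
      hk.map_pow hα, ← mul_assoc, (k.cn_proj 1).isIdempotentElem.eq]
    exact k.K.e_mul _ z.2
  · rw [incl_split_snd, map_zero, map_mul, ← mul_assoc]
    suffices h : k.cn 1 * (α ^ m) (k.cn (n + 1) - k.cn n) = 0 by rw [h, zero_mul]
    rcases lt_or_gt_of_ne hm with hmn | hmn
    · obtain ⟨j, rfl⟩ := Nat.exists_eq_add_of_lt hmn
      rw [map_sub, show m + j + 1 + 1 = (j + 2) + m by ring, show m + j + 1 = (j + 1) + m by ring,
        hk.map_pow hα, hk.map_pow hα, mul_sub, hk.mul_of_le' (by omega), hk.mul_of_le' (by omega),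
        sub_self]
    · obtain ⟨j, rfl⟩ := Nat.exists_eq_add_of_lt hmn
      rw [map_sub, show n + j + 1 = j + (n + 1) by ring, pow_add_apply, hk.map_eq_zero,
        show j + (n + 1) = (j + 1) + n by ring, pow_add_apply, hk.map_eq_zero, map_zero, map_zero,
        sub_zero, mul_zero]

theorem split_of_mem_P (x : k.P) :
    k.split ⟨k.P.incl x, (k.mem_P.1 x.2).1⟩ = (x, 0) := by
  have hx : k.c * k.P.incl x = 0 := (k.mem_P.1 x.2).2
  refine Prod.ext (SubCStar.incl_injective ?_)
    (BoundedContinuousFunction.ext fun n => SubCStar.incl_injective ?_)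
  · rw [incl_split_fst, sub_mul, one_mul, hx, sub_zero]
  · rw [incl_split_snd]
    have h1 : (α ^ n) k.c = k.c := by
      induction n with
      | zero => rfl
      | succ n ih => rw [pow_succ_apply, k.c_fixed, ih]
    rw [← k.cn_mul_c, mul_assoc]
    nth_rw 1 [← h1]
    rw [← map_mul, hx, map_zero, mul_zero]
    rfl

theorem split_surjective (hα : IsNormalMap α) : Function.Surjective k.split := by
  rintro ⟨x, y⟩
  have := isWStar_tail hα
  have := k.isWStar_P hα
  have := k.isWStar_K hα
  choose s hs1 hs2 hs3 using fun n => k.exists_split_eq_single hα n (y n)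
  let T : ℕ → tail α := fun N => ∑ n ∈ Finset.range N, s n
  have hT1 : ∀ N, (k.split (T N)).1 = 0 := by
    intro N
    rw [map_sum, Prod.fst_sum]
    exact Finset.sum_eq_zero fun n _ => hs1 n
  have hT2 : ∀ N m, (k.split (T N)).2 m = if m < N then y m else 0 := by
    intro N m
    rw [map_sum, Prod.snd_sum, BoundedContinuousFunction.sum_apply]
    split_ifs with h
    · rw [Finset.sum_eq_single m (fun n _ hn => hs3 n m hn.symm)
        (fun h' => absurd (Finset.mem_range.2 h) h'), hs2]
    · refine Finset.sum_eq_zero fun n hn => hs3 n m ?_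
      rintro rfl
      exact h (Finset.mem_range.1 hn)
  -- Injectivity makes `split` isometric, so the partial sums are bounded through their coordinates
  -- and have a weak cluster point.
  have hTn : ∀ N, ‖T N‖ ≤ ‖y‖ := by
    intro N
    rw [← NonUnitalStarAlgHom.norm_map k.split (k.split_injective hα)]
    refine max_le (by rw [hT1, norm_zero]; exact norm_nonneg y) ?_
    refine (BoundedContinuousFunction.norm_le (norm_nonneg y)).2 fun m => ?_
    rw [hT2]
    split_ifs
    · exact y.norm_coe_le_norm m
    · rw [norm_zero]
      exact norm_nonneg y
  let u := Ultrafilter.of (atTop : Filter ℕ)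
  obtain ⟨t, _, ht⟩ := exists_wlim u T (Eventually.of_forall hTn)
  have h1 := (k.isWMap_split hα).tendsto (Eventually.of_forall hTn) ht
  have h2 : Tendsto (fun N => k.split (T N)) u (wnhds ((0, y) : k.P × (ℕ →ᵇ k.K))) := by
    refine Prod.tendsto_wnhds.2 ⟨(wnhds_const 0).congr fun N => (hT1 N).symm,
      BoundedContinuousFunction.tendsto_wnhds.2 fun m => (wnhds_const (y m)).congr' ?_⟩
    refine Ultrafilter.of_le (atTop : Filter ℕ) ?_
    filter_upwards [eventually_gt_atTop m] with N hN
    rw [hT2, if_pos hN]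
  refine ⟨⟨k.P.incl x, (k.mem_P.1 x.2).1⟩ + t, ?_⟩
  rw [map_add, k.split_of_mem_P, wlim_unique h1 h2]
  simp

/-- The isomorphism of the tail algebra with `P ⊕ ℓ^∞(ℕ, K)`. -/
def splitEquiv (hα : IsNormalMap α) : tail α ≃⋆ₐ[ℂ] (k.P × (ℕ →ᵇ k.K)) :=
  StarAlgEquiv.ofBijective k.split ⟨k.split_injective hα, k.split_surjective hα⟩

theorem split_map (hα : IsNormalMap α) (t : tail α) :
    k.split ⟨α t, map_mem_tail t.2⟩ =
      (k.autP hα (k.split t).1, backwardShift (k.split t).2) := by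
  refine Prod.ext (SubCStar.incl_injective ?_)
    (BoundedContinuousFunction.ext fun n => SubCStar.incl_injective ?_)
  · change (1 - k.c) * α (t : A) = α ((1 - k.c) * (t : A))
    rw [map_mul, map_sub, map_one, k.c_fixed]
  · change k.cn 1 * (α ^ n) (α (t : A)) = k.cn 1 * (α ^ (n + 1)) (t : A)
    rw [pow_succ_apply]

/-- The canonical decomposition of the tail algebra. -/
def tailDecomposition (hα : IsNormalMap α) : TailDecomposition α where
  toKernelProjections := k
  β := k.autP hα
  β_eq _ := rfl
  θ := (k.splitEquiv hα).symm
  θ_normal := by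
    have := isWStar_tail hα
    have := k.isWStar_P hα
    have := k.isWStar_K hα
    exact StarAlgEquiv.isNormalMap_of_isWMap
      (IsWMap.symm (Φ := k.splitEquiv hα) (k.isWMap_split hα))
  θ_shift x y := by
    obtain ⟨t, ht⟩ : ∃ t, k.splitEquiv hα t = (x, y) := k.split_surjective hα (x, y)
    have h1 : k.splitEquiv hα ⟨α t, map_mem_tail t.2⟩ = (k.autP hα x, backwardShift y) := by
      have := k.split_map hα t
      rwa [show k.split t = (x, y) from ht] at this
    rw [← ht, ← h1, StarAlgEquiv.symm_apply_apply, StarAlgEquiv.symm_apply_apply]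

end KernelProjections

theorem nonempty_tailDecomposition {A : Type*} [CStarAlgebra A] [WeakOp A] [IsWAlg A]
    {α : A →⋆ₐ[ℂ] A} (hα : IsNormalMap α) : Nonempty (TailDecomposition α) :=
  (nonempty_kernelProjections hα).map fun k => k.tailDecomposition hα

end Decomposition

/-! ### Matrices -/

section Matrices

attribute [local instance] CStarAlgebra.spectralOrder CStarAlgebra.spectralOrderedRing

theorem norm_matrix_map_le {A B : Type*} [CStarAlgebra A] [CStarAlgebra B] (f : A →⋆ₙₐ[ℂ] B) {k : ℕ}
    (X : CStarMatrix (Fin k) (Fin k) A) : ‖X.map f‖ ≤ ‖X‖ :=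
  NonUnitalStarAlgHom.norm_apply_le (CStarMatrix.mapₙₐ f) X

/-- Each entry occurs linearly between fixed factors, so these inner products, which detect the norm
of a matrix, are weakly continuous in the entries. -/
theorem inner_toCLM_eq_sum {A : Type*} [CStarAlgebra A] {k : ℕ} (X : CStarMatrix (Fin k) (Fin k) A)
    (v w : WithCStarModule A (Fin k → A)) :
    inner A w (CStarMatrix.toCLM X v) = ∑ j, ∑ i, v i * X i j * star (w j) := by
  rw [CStarMatrix.toCLM_apply_eq_sum, WithCStarModule.pi_inner]
  refine Finset.sum_congr rfl fun j _ => ?_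
  rw [WithCStarModule.inner_def, ← Finset.sum_mul]
  rfl

variable {A : Type*} [CStarAlgebra A] [WeakOp A]

/-- The unit ball of `M_k(A)` is closed under entrywise weak limits. -/
theorem norm_matrix_le_of_wlim [IsWAlg A] {k : ℕ} {ι : Type*} {l : Filter ι} [l.NeBot]
    {Z : ι → CStarMatrix (Fin k) (Fin k) A} {T : CStarMatrix (Fin k) (Fin k) A}
    (hZ : ∀ᶠ n in l, ‖Z n‖ ≤ 1)
    (hT : ∀ i j, Tendsto (fun n => Z n i j) l (wnhds (T i j))) : ‖T‖ ≤ 1 := by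
  refine CStarMatrix.norm_le_of_forall_inner_le (C := 1) fun v w => ?_
  have h1 : Tendsto (fun n => inner A w (CStarMatrix.toCLM (Z n) v)) l
      (wnhds (inner A w (CStarMatrix.toCLM T v))) := by
    simp only [inner_toCLM_eq_sum]
    refine wnhds_sum _ fun j _ => wnhds_sum _ fun i _ => ?_
    exact (IsWAlg.mul_right _ _).comp ((IsWAlg.mul_left _ _).comp (hT i j))
  refine norm_le_of_wlim ?_ h1
  filter_upwards [hZ] with n hn
  refine (CStarModule.norm_inner_le (A := A) (WithCStarModule A (Fin k → A))).trans ?_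
  rw [mul_comm]
  gcongr
  refine ((CStarMatrix.toCLM (Z n)).le_opNorm v).trans ?_
  gcongr
  exact hn

theorem tendsto_matrixFunctional [IsWStar A] {k : ℕ} (ρ : Fin k → Fin k → predual A)
    {ι : Type*} {l : Filter ι} {Z : ι → CStarMatrix (Fin k) (Fin k) A}
    {T : CStarMatrix (Fin k) (Fin k) A} (hZ : ∀ᶠ n in l, ‖Z n‖ ≤ 1)
    (hT : ∀ i j, Tendsto (fun n => Z n i j) l (wnhds (T i j))) :
    Tendsto (fun n => matrixFunctional ρ (Z n)) l (𝓝 (matrixFunctional ρ T)) := by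
  refine tendsto_finsetSum _ fun i _ => tendsto_finsetSum _ fun j _ => ?_
  exact predual_tendsto (ρ i j).2 (hZ.mono fun n hn => CStarMatrix.norm_entry_le_norm.trans hn)
    (hT i j)

theorem le_normComp {B : Type*} [CStarAlgebra B] {k : ℕ} (ρ : Fin k → Fin k → predual A)
    (Φ : B →ₗ[ℂ] A) {X : CStarMatrix (Fin k) (Fin k) B} (hX : ‖X‖ ≤ 1) :
    ‖matrixFunctional ρ (X.map Φ)‖ₑ ≤ normComp ρ Φ :=
  le_iSup₂ (f := fun (X : CStarMatrix (Fin k) (Fin k) B) (_ : ‖X‖ ≤ 1) =>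
    ‖matrixFunctional ρ (X.map Φ)‖ₑ) X hX

/-- Comparison of norms of functionals on matrix algebras. -/
theorem normComp_le {B C A' : Type*} [CStarAlgebra B] [CStarAlgebra C] [CStarAlgebra A'] [WeakOp A']
    {k : ℕ} {ρ : Fin k → Fin k → predual A} {σ : Fin k → Fin k → predual A'} {Φ : B →ₗ[ℂ] A}
    {Ψ : C →ₗ[ℂ] A'} (g : B → C)
    (hg : ∀ X : CStarMatrix (Fin k) (Fin k) B, ‖X.map g‖ ≤ ‖X‖)
    (h : ∀ i j x, (ρ i j : StrongDual ℂ A) (Φ x) = (σ i j : StrongDual ℂ A') (Ψ (g x))) :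
    normComp ρ Φ ≤ normComp σ Ψ := by
  refine iSup₂_le fun X hX => ?_
  refine le_of_eq_of_le ?_ (le_normComp σ Ψ ((hg X).trans hX))
  congr 1
  exact Finset.sum_congr rfl fun i _ => Finset.sum_congr rfl fun j _ => h i j (X i j)

/-- The identification of `A` with the `1 × 1` matrices over `A`. -/
def oneByOne {A : Type*} [CStarAlgebra A] : A →⋆ₙₐ[ℂ] CStarMatrix (Fin 1) (Fin 1) A where
  toFun a := CStarMatrix.ofMatrix fun _ _ => a
  map_smul' _ _ := rfl
  map_zero' := rfl
  map_add' _ _ := rfl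
  map_mul' a b := by
    ext i j
    simp only [CStarMatrix.mul_apply, Finset.univ_unique, Finset.sum_singleton]
    rfl
  map_star' _ := rfl

theorem normComp_one {B : Type*} [CStarAlgebra B] (ρ : predual A) (Φ : B →ₗ[ℂ] A) :
    normComp (k := 1) (fun _ _ => ρ) Φ =
      ⨆ x : B, ⨆ _ : ‖x‖ ≤ 1, ‖(ρ : StrongDual ℂ A) (Φ x)‖ₑ := by
  have h : ∀ X : CStarMatrix (Fin 1) (Fin 1) B,
      matrixFunctional (k := 1) (fun _ _ => ρ) (X.map Φ) = (ρ : StrongDual ℂ A) (Φ (X 0 0)) := by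
    intro X
    simp [matrixFunctional]
  refine le_antisymm (iSup₂_le fun X hX => ?_) (iSup₂_le fun x hx => ?_)
  · rw [h]
    exact le_iSup₂ (f := fun (x : B) (_ : ‖x‖ ≤ 1) => ‖(ρ : StrongDual ℂ A) (Φ x)‖ₑ) (X 0 0)
      (CStarMatrix.norm_entry_le_norm.trans hX)
  · have hX : ‖oneByOne x‖ ≤ 1 := (NonUnitalStarAlgHom.norm_apply_le oneByOne x).trans hx
    refine le_of_eq_of_le ?_ (le_normComp (fun _ _ => ρ) Φ hX)
    rw [h]
    rfl

end Matrices

/-! ### The lift of the endomorphism -/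

section Lift

attribute [local instance] CStarAlgebra.spectralOrder CStarAlgebra.spectralOrderedRing

/-- Extension of a family indexed by `1, 2, …` to `ℤ` by zero. -/
def extendByZero {K : Type*} [CStarAlgebra K] : (ℕ →ᵇ K) →⋆ₙₐ[ℂ] (ℤ →ᵇ K) where
  toFun y := BoundedContinuousFunction.ofNormedAddCommGroupDiscrete
    -- The coordinate of index `n ≥ 1` is stored in `y` at `n - 1`.
    (fun n : ℤ => if 1 ≤ n then y (n - 1).toNat else 0) ‖y‖ fun n => by
      split_ifs
      · exact y.norm_coe_le_norm _
      · simp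
  map_smul' r y := by ext n; by_cases h : 1 ≤ n <;> simp [h]
  map_zero' := by ext n; by_cases h : 1 ≤ n <;> simp
  map_add' x y := by ext n; by_cases h : 1 ≤ n <;> simp [h]
  map_mul' x y := by ext n; by_cases h : 1 ≤ n <;> simp [h]
  map_star' y := by ext n; by_cases h : 1 ≤ n <;> simp [h]

theorem positivePart_extendByZero {K : Type*} [CStarAlgebra K] (y : ℕ →ᵇ K) :
    positivePart (extendByZero y) = y := by
  ext n
  change (if (1 : ℤ) ≤ n + 1 then y ((n : ℤ) + 1 - 1).toNat else 0) = y n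
  simp

namespace TailDecomposition

variable {A : Type*} [CStarAlgebra A] [WeakOp A] {α : A →⋆ₐ[ℂ] A} (D : TailDecomposition α)

theorem E_apply (x : D.Lift) : D.E x = D.θ (x.1, positivePart x.2) := rfl

theorem E_liftAut (x : D.Lift) : D.E (D.liftAut x) = α (D.E x) := by
  rw [E_apply, E_apply, ← D.θ_shift]
  have : positivePart (bilateralShift x.2) = backwardShift (positivePart x.2) := by
    ext n
    change x.2 ((n : ℤ) + 1 + 1) = x.2 (((n + 1 : ℕ) : ℤ) + 1)
    push_cast
    rfl
  rw [← this]
  rfl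

theorem E_liftAut_pow (n : ℕ) (x : D.Lift) : D.E ((D.liftAut ^ n) x) = (α ^ n) (D.E x) := by
  induction n with
  | zero => rfl
  | succ n ih =>
    rw [pow_succ', StarAlgEquiv.mul_apply, E_liftAut, ih, pow_succ_apply']

theorem liftAut_zpow_snd (n : ℤ) (x : D.Lift) (m : ℤ) :
    ((D.liftAut ^ n) x).2 m = x.2 (m + n) := by
  induction n generalizing m with
  | zero =>
    rw [add_zero]
    rfl
  | succ n ih =>
    rw [add_comm, zpow_one_add, StarAlgEquiv.mul_apply]
    change ((D.liftAut ^ (n : ℤ)) x).2 (m + 1) = _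
    rw [ih, add_assoc]
  | pred n ih =>
    rw [sub_eq_add_neg, add_comm, zpow_add, zpow_neg_one, StarAlgEquiv.mul_apply,
      StarAlgEquiv.aut_inv]
    change ((D.liftAut ^ (-(n : ℤ))) x).2 (m - 1) = _
    rw [ih, sub_add_eq_add_sub, add_comm (-1 : ℤ), ← add_assoc]
    rfl

/-- The `P` component is visible at power 0, and the power `m - 1` moves coordinate `m` to
coordinate 1, the first that `E` retains. -/
theorem eq_zero_of_E_zpow (x : D.Lift) (h : ∀ n : ℤ, D.E ((D.liftAut ^ n) x) = 0) : x = 0 := by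
  have h1 : ∀ n : ℤ, ((D.liftAut ^ n) x).1 = 0 ∧ positivePart ((D.liftAut ^ n) x).2 = 0 := by
    intro n
    have h2 : D.θ (((D.liftAut ^ n) x).1, positivePart ((D.liftAut ^ n) x).2) = 0 :=
      Subtype.ext (h n)
    have h3 := (map_eq_zero_iff D.θ (EquivLike.injective D.θ)).1 h2
    exact ⟨congrArg Prod.fst h3, congrArg Prod.snd h3⟩
  refine Prod.ext (h1 0).1 (BoundedContinuousFunction.ext fun m => ?_)
  have h2 := DFunLike.congr_fun (h1 (m - 1)).2 0
  change ((D.liftAut ^ (m - 1)) x).2 ((0 : ℕ) + 1) = 0 at h2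
  rw [liftAut_zpow_snd] at h2
  rwa [show ((0 : ℕ) : ℤ) + 1 + (m - 1) = m by push_cast; ring] at h2

/-- A section of `E` over the tail algebra. -/
def sect : tail α →⋆ₙₐ[ℂ] D.Lift :=
  (NonUnitalStarAlgHom.prod (NonUnitalStarAlgHom.fst ℂ _ _)
    (extendByZero.comp (NonUnitalStarAlgHom.snd ℂ _ _))).comp
    (D.θ.symm : tail α →⋆ₙₐ[ℂ] _)

theorem E_sect (t : tail α) : D.E (D.sect t) = t := by
  change ((D.θ ((D.θ.symm t).1, positivePart (extendByZero (D.θ.symm t).2)) : tail α) : A) = t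
  rw [positivePart_extendByZero, Prod.mk.eta, StarAlgEquiv.apply_symm_apply]

theorem range_E : Set.range D.E = tail α := by
  ext t
  constructor
  · rintro ⟨x, rfl⟩
    exact (D.θ _).2
  · intro ht
    exact ⟨_, D.E_sect ⟨t, ht⟩⟩

variable [IsWAlg A]

theorem isWStar_lift (hα : IsNormalMap α) : IsWStar D.Lift := by
  have := D.isWStar_P hα
  have := D.isWStar_K hα
  infer_instance

theorem isWMap_E (hα : IsNormalMap α) : IsWMap D.E := by
  have := D.isWStar_P hα
  have := D.isWStar_K hα
  have := isWStar_tail hα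
  intro l x C hl hx hlx
  have h1 := Prod.tendsto_wnhds (f := id).1 hlx
  have h2 : Tendsto (fun x : D.Lift => ((x.1, positivePart x.2) :
      D.toKernelProjections.P × (ℕ →ᵇ D.toKernelProjections.K))) l
      (wnhds (x.1, positivePart x.2)) := Prod.tendsto_wnhds.2 ⟨h1.1,
    BoundedContinuousFunction.tendsto_wnhds.2 fun n =>
      BoundedContinuousFunction.tendsto_wnhds.1 h1.2 ((n : ℤ) + 1)⟩
  have h3 : ∀ᶠ x : D.Lift in l, ‖((x.1, positivePart x.2) :
      D.toKernelProjections.P × (ℕ →ᵇ D.toKernelProjections.K))‖ ≤ C := by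
    filter_upwards [hl] with y hy
    refine max_le ((norm_fst_le y).trans hy) (le_trans ?_ ((norm_snd_le y).trans hy))
    exact NonUnitalStarAlgHom.norm_apply_le positivePart y.2
  exact StarSubalgebra.tendsto_wnhds.1 ((isWMap_of_isNormalMap D.θ_normal).tendsto h3 h2)

theorem isNormalMap_E (hα : IsNormalMap α) : IsNormalMap D.E :=
  StarAlgHom.isNormalMap_of_isWMap (D.isWMap_E hα)

theorem isWMap_liftAut (hα : IsNormalMap α) : IsWMap D.liftAut := by
  have := D.isWStar_P hα
  intro l x C hl hx hlx
  have h1 := Prod.tendsto_wnhds (f := id).1 hlx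
  refine Prod.tendsto_wnhds.2 ⟨SubCStar.tendsto_wnhds.2 ?_,
    BoundedContinuousFunction.tendsto_wnhds.2 fun n =>
      BoundedContinuousFunction.tendsto_wnhds.1 h1.2 (n + 1)⟩
  have h2 : Tendsto (fun y : D.Lift => α (D.toKernelProjections.P.incl y.1)) l
      (wnhds (α (D.toKernelProjections.P.incl x.1))) :=
    (isWMap_of_isNormalMap hα).tendsto (hl.mono fun y hy => (norm_fst_le y).trans hy)
      (SubCStar.tendsto_wnhds.1 h1.1)
  rw [← D.β_eq] at h2
  exact h2.congr fun y => (D.β_eq y.1).symm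

theorem isNormalMap_liftAut (hα : IsNormalMap α) : IsNormalMap D.liftAut := by
  have := D.isWStar_lift hα
  exact StarAlgEquiv.isNormalMap_of_isWMap (D.isWMap_liftAut hα)

theorem isNormalMap_liftAut_symm (hα : IsNormalMap α) : IsNormalMap D.liftAut.symm := by
  have := D.isWStar_lift hα
  exact StarAlgEquiv.isNormalMap_of_isWMap (D.isWMap_liftAut hα).symm

/-- The norms of `ρ ∘ (id_k ⊗ α^n)` converge to the norm of `ρ ∘ (id_k ⊗ E)`. -/
theorem tendsto_normComp (hα : IsNormalMap α) {k : ℕ} (ρ : Fin k → Fin k → predual A) :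
    Tendsto (fun n : ℕ => normComp ρ (α ^ n : A →⋆ₐ[ℂ] A).toAlgHom.toLinearMap) atTop
      (𝓝 (normComp ρ D.E.toAlgHom.toLinearMap)) := by
  -- `α^(n+1)` is `α^n` composed with `α`, which is contractive on matrices.
  have hanti : Antitone fun n : ℕ => normComp ρ (α ^ n : A →⋆ₐ[ℂ] A).toAlgHom.toLinearMap := by
    refine antitone_nat_of_succ_le fun n => ?_
    refine normComp_le α (fun X => norm_matrix_map_le (α : A →⋆ₙₐ[ℂ] A) X) fun i j x => ?_
    exact congrArg _ (pow_succ_apply α n x)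
  -- `E` factors as `α^n` after the contraction `g`, that is, `E` preceded by the inverse of the
  -- `n`-th power of the automorphism.
  have hlow : ∀ n : ℕ, normComp ρ D.E.toAlgHom.toLinearMap ≤
      normComp ρ (α ^ n : A →⋆ₐ[ℂ] A).toAlgHom.toLinearMap := by
    intro n
    let g : D.Lift →⋆ₙₐ[ℂ] A :=
      (D.E : D.Lift →⋆ₙₐ[ℂ] A).comp (((D.liftAut ^ n).symm : D.Lift ≃⋆ₐ[ℂ] D.Lift) :
        D.Lift →⋆ₙₐ[ℂ] D.Lift)
    refine normComp_le g (fun X => norm_matrix_map_le g X) fun i j x => congrArg _ ?_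
    change D.E x = (α ^ n) (D.E ((D.liftAut ^ n).symm x))
    rw [← D.E_liftAut_pow, StarAlgEquiv.apply_symm_apply]
  have hinf : ⨅ n : ℕ, normComp ρ (α ^ n : A →⋆ₐ[ℂ] A).toAlgHom.toLinearMap =
      normComp ρ D.E.toAlgHom.toLinearMap := by
    refine le_antisymm (le_of_forall_lt fun r hr => ?_) (le_iInf hlow)
    obtain ⟨r', hrr', hr'⟩ := exists_between hr
    refine hrr'.trans_le ?_
    have h1 : ∀ n : ℕ, ∃ X : CStarMatrix (Fin k) (Fin k) A, ‖X‖ ≤ 1 ∧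
        r' < ‖matrixFunctional ρ (X.map (α ^ n : A →⋆ₐ[ℂ] A))‖ₑ := by
      intro n
      have := hr'.trans_le (iInf_le _ n)
      simp only [normComp, lt_iSup_iff, exists_prop] at this
      exact this
    choose X hX1 hX2 using h1
    let Z : ℕ → CStarMatrix (Fin k) (Fin k) A := fun n => (X n).map (α ^ n : A →⋆ₐ[ℂ] A)
    have hZ : ∀ n, ‖Z n‖ ≤ 1 := fun n =>
      (norm_matrix_map_le ((α ^ n : A →⋆ₐ[ℂ] A) : A →⋆ₙₐ[ℂ] A) (X n)).trans (hX1 n)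
    have hZe : ∀ i j n, ‖Z n i j‖ ≤ 1 := fun i j n => CStarMatrix.norm_entry_le_norm.trans (hZ n)
    let u := Ultrafilter.of (atTop : Filter ℕ)
    -- Cluster points are taken entry by entry along one ultrafilter. They lie in the tail algebra
    -- since the entries of `Z m` lie in `α^n(A)` once `m ≥ n`.
    choose T _ hT using fun i j => exists_wlim u (fun n => Z n i j)
      (Eventually.of_forall (hZe i j))
    have hmem : ∀ i j, T i j ∈ tail α := by
      intro i j
      refine mem_tail_of_wlim hα (Eventually.of_forall (hZe i j)) (fun n => ?_) (hT i j)
      refine Ultrafilter.of_le (atTop : Filter ℕ) ?_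
      filter_upwards [eventually_ge_atTop n] with m hm
      obtain ⟨d, rfl⟩ := Nat.exists_eq_add_of_le hm
      exact ⟨_, (pow_add_apply α n d _).symm⟩
    let _ : PartialOrder (tail α) := CStarAlgebra.spectralOrder (tail α)
    have _ : StarOrderedRing (tail α) := CStarAlgebra.spectralOrderedRing (tail α)
    let S : CStarMatrix (Fin k) (Fin k) (tail α) :=
      CStarMatrix.ofMatrix fun i j => ⟨T i j, hmem i j⟩
    have hST : S.map ((tail α).subtype : tail α →⋆ₐ[ℂ] A) = CStarMatrix.ofMatrix T := rfl
    have hS : ‖S‖ ≤ 1 := by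
      have h2 : ‖S.map ((tail α).subtype : tail α →⋆ₐ[ℂ] A)‖ = ‖S‖ :=
        NonUnitalStarAlgHom.norm_map
          (CStarMatrix.mapₙₐ ((tail α).subtype : tail α →⋆ₙₐ[ℂ] A))
          (CStarMatrix.map_injective Subtype.val_injective) S
      rw [← h2, hST]
      exact norm_matrix_le_of_wlim (l := (u : Filter ℕ)) (Eventually.of_forall hZ) hT
    have h3 : r' ≤ ‖matrixFunctional ρ (CStarMatrix.ofMatrix T)‖ₑ := by
      have h4 := (tendsto_matrixFunctional ρ (l := (u : Filter ℕ)) (T := CStarMatrix.ofMatrix T)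
        (Eventually.of_forall hZ) hT).enorm
      exact ge_of_tendsto h4 (Eventually.of_forall fun n => (hX2 n).le)
    refine h3.trans ?_
    -- The contractive section lifts the limit matrix to the unit ball over the lift, where `E`
    -- attains the same value.
    have h5 : (S.map D.sect).map D.E.toAlgHom.toLinearMap = CStarMatrix.ofMatrix T := by
      ext i j
      exact D.E_sect _
    rw [← h5]
    exact le_normComp ρ _ ((norm_matrix_map_le D.sect S).trans hS)
  rw [← hinf]
  exact tendsto_atTop_iInf hanti

theorem isEndoAsymptoticLift (hα : IsNormalMap α) : IsEndoAsymptoticLift α D.liftAut D.E where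
  isVonNeumann := by
    have := D.isWStar_lift hα
    exact isVonNeumann_of_isWStar
  normal_E := D.isNormalMap_E hα
  equivariant := D.E_liftAut
  nondegenerate := D.eq_zero_of_E_zpow
  range_eq := D.range_E
  tendsto_norm ρ hρ := by
    have h := D.tendsto_normComp hα (k := 1) fun _ _ => ⟨ρ, hρ⟩
    simp only [normComp_one] at h
    exact h

end TailDecomposition

end Lift

/-! ### Compressions -/

section Compression

attribute [local instance] CStarAlgebra.spectralOrder CStarAlgebra.spectralOrderedRing

/-- An injective `*`-homomorphism reflects positivity. -/
theorem nonneg_of_map_nonneg {B C : Type*} [NonUnitalCStarAlgebra B] [NonUnitalCStarAlgebra C]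
    [PartialOrder B] [StarOrderedRing B] [PartialOrder C] [StarOrderedRing C]
    (f : B →⋆ₙₐ[ℂ] C) (hf : Function.Injective f) {b : B} (h : 0 ≤ f b) : 0 ≤ b := by
  have hb : IsSelfAdjoint b := hf (by
    rw [map_star]
    exact (IsSelfAdjoint.of_nonneg h).star_eq)
  -- Positivity is the vanishing of the negative part, which `f` preserves as a functional calculus.
  rw [← CFC.negPart_eq_zero_iff b hb]
  refine hf ?_
  have hfb : IsSelfAdjoint (f b) := IsSelfAdjoint.of_nonneg h
  have hc : Continuous f := map_continuous f
  rw [map_zero, ← (CFC.negPart_eq_zero_iff (f b) hfb).2 h, CFC.negPart_def, CFC.negPart_def]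
  exact NonUnitalStarAlgHomClass.map_cfcₙ f (fun x : ℝ => x⁻) b

namespace SubCStar

variable {A : Type*} [CStarAlgebra A]

/-- The inclusion of `S` in `A` as a `*`-homomorphism. -/
def inclHom (S : SubCStar A) : S →⋆ₙₐ[ℂ] A where
  toFun := S.incl
  map_smul' _ _ := rfl
  map_zero' := rfl
  map_add' _ _ := rfl
  map_mul' _ _ := rfl
  map_star' _ := rfl

theorem isNormalMap_incl [WeakOp A] [IsWStar A] (S : SubCStar A) : IsNormalMap S.incl :=
  IsWMap.isNormalMap (Φ := S.incl.mkContinuous 1 fun x => by rw [one_mul]; exact le_rfl)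
    fun _ _ _ _ _ hl => SubCStar.tendsto_wnhds (f := id).1 hl

end SubCStar

variable {A : Type*} [CStarAlgebra A] {p : A} (hp : IsStarProjection p)

theorem mem_corner {x : A} : x ∈ (corner p hp).carrier ↔ p * x * p = x := by
  have h1 : p * p = p := hp.isIdempotentElem
  constructor
  · rintro ⟨y, rfl⟩
    calc p * (p * y * p) * p = (p * p) * y * (p * p) := by simp only [mul_assoc]
      _ = _ := by rw [h1]
  · exact fun h => ⟨x, h.symm⟩

theorem incl_compress (x : A) : (corner p hp).incl (compress p hp x) = p * x * p := rfl

theorem compress_incl (x : corner p hp) : compress p hp ((corner p hp).incl x) = x :=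
  SubCStar.incl_injective ((mem_corner hp).1 x.2)

theorem compress_one : compress p hp 1 = 1 := by
  refine SubCStar.incl_injective ?_
  rw [incl_compress, mul_one, hp.isIdempotentElem.eq]
  rfl

/-- The diagonal matrix with entries `p`. -/
def diagMatrix (k : ℕ) (p : A) : CStarMatrix (Fin k) (Fin k) A :=
  CStarMatrix.ofMatrix (Matrix.diagonal fun _ => p)

theorem diagMatrix_mul_mul {k : ℕ} (p : A) (X : CStarMatrix (Fin k) (Fin k) A) (i j : Fin k) :
    (diagMatrix k p * X * diagMatrix k p) i j = p * X i j * p := by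
  have h : ∀ Y : Matrix (Fin k) (Fin k) A,
      (Matrix.diagonal (fun _ => p) * Y * Matrix.diagonal (fun _ => p) :
        Matrix (Fin k) (Fin k) A) i j = p * Y i j * p :=
    fun Y => by rw [Matrix.mul_diagonal, Matrix.diagonal_mul]
  exact h (CStarMatrix.ofMatrix.symm X)

theorem isStarProjection_diagMatrix {p : A} (hp : IsStarProjection p) (k : ℕ) :
    IsStarProjection (diagMatrix k p) := by
  have h1 : Matrix.diagonal (fun _ : Fin k => p) * Matrix.diagonal (fun _ => p) =
      Matrix.diagonal (fun _ => p) := by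
    rw [Matrix.diagonal_mul_diagonal, hp.isIdempotentElem.eq]
  have h2 : (Matrix.diagonal (fun _ : Fin k => p)).conjTranspose =
      Matrix.diagonal (fun _ => p) := by
    rw [Matrix.diagonal_conjTranspose]
    exact congrArg Matrix.diagonal (funext fun _ => hp.isSelfAdjoint.star_eq)
  exact ⟨h1, h2⟩

/-- Entrywise compression by `p` is compression by one projection of the matrix algebra; this makes
it contractive and positive at every matrix level. -/
theorem map_incl_map_compress {k : ℕ} (X : CStarMatrix (Fin k) (Fin k) A) :
    (X.map (compress p hp)).map (corner p hp).incl = diagMatrix k p * X * diagMatrix k p := by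
  ext i j
  rw [diagMatrix_mul_mul]
  rfl

theorem norm_map_incl {k : ℕ} (S : SubCStar A) (X : CStarMatrix (Fin k) (Fin k) S) :
    ‖X.map S.incl‖ = ‖X‖ :=
  NonUnitalStarAlgHom.norm_map (CStarMatrix.mapₙₐ S.inclHom)
    (CStarMatrix.map_injective SubCStar.incl_injective) X

theorem norm_map_compress_le {k : ℕ} (X : CStarMatrix (Fin k) (Fin k) A) :
    ‖X.map (compress p hp)‖ ≤ ‖X‖ := by
  rw [← norm_map_incl, map_incl_map_compress]
  have h := IsStarProjection.norm_le _ (isStarProjection_diagMatrix hp k)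
  calc _ ≤ ‖diagMatrix k p‖ * ‖X‖ * ‖diagMatrix k p‖ :=
        (norm_mul_le _ _).trans (by gcongr; exact norm_mul_le _ _)
    _ ≤ 1 * ‖X‖ * 1 := by gcongr
    _ = ‖X‖ := by ring

/-- The compression of a `*`-homomorphism is completely positive. -/
theorem exists_completelyPositive {B : Type*} [CStarAlgebra B] (f : B →⋆ₙₐ[ℂ] A)
    (Φ : B →ₗ[ℂ] corner p hp) (hΦ : ∀ b, Φ b = compress p hp (f b)) :
    ∃ Ψ : B →CP corner p hp, ∀ b, Ψ b = Φ b := by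
  refine ⟨⟨Φ, fun k X hX => ?_⟩, fun b => rfl⟩
  refine nonneg_of_map_nonneg (CStarMatrix.mapₙₐ (corner p hp).inclHom)
    (CStarMatrix.map_injective SubCStar.incl_injective) ?_
  have h1 : 0 ≤ CStarMatrix.mapₙₐ f X := map_nonneg _ hX
  have h2 : CStarMatrix.mapₙₐ (corner p hp).inclHom (X.map Φ) =
      diagMatrix k p * CStarMatrix.mapₙₐ f X * diagMatrix k p := by
    rw [← map_incl_map_compress hp]
    ext i j
    exact congrArg (corner p hp).incl (hΦ (X i j))
  rw [h2]
  exact (isStarProjection_diagMatrix hp k).isSelfAdjoint.conjugate_nonneg h1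

/-! ### Powers of the compressed endomorphism. -/

section Endomorphism

variable {α : A →⋆ₐ[ℂ] A}

/-- The hypothesis is `p ≤ α(p)` in multiplicative form; applying `α^n` makes the projections
`α^n(p)` increase, so all of them dominate `p`. -/
theorem mul_pow_eq {p : A} (hp : IsStarProjection p)
    (hpα : p * α p = p) (n : ℕ) : p * (α ^ n) p = p := by
  induction n with
  | zero => exact hp.isIdempotentElem
  | succ n ih =>
    have h := congrArg (α ^ n) hpα
    rw [map_mul, ← pow_succ_apply] at h
    calc p * (α ^ (n + 1)) p = p * ((α ^ n) p * (α ^ (n + 1)) p) := by rw [← mul_assoc, ih]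
      _ = p := by rw [h, ih]

theorem pow_mul_eq {p : A} (hp : IsStarProjection p)
    (hpα : p * α p = p) (n : ℕ) : (α ^ n) p * p = p := by
  have h := congrArg star (mul_pow_eq hp hpα n)
  rwa [star_mul, ← map_star, hp.isSelfAdjoint.star_eq] at h

/-- The outer `p` absorbs `α^n(p)` on both sides. This is why powers of `φ` are compressions of
powers of `α`. -/
theorem compress_pow_compress {p : A} (hp : IsStarProjection p)
    (hpα : p * α p = p) (n : ℕ) (x : A) :
    compress p hp ((α ^ n) (p * x * p)) = compress p hp ((α ^ n) x) := by
  refine SubCStar.incl_injective ?_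
  rw [incl_compress, incl_compress, map_mul, map_mul]
  calc p * ((α ^ n) p * (α ^ n) x * (α ^ n) p) * p
      = (p * (α ^ n) p) * (α ^ n) x * ((α ^ n) p * p) := by simp only [mul_assoc]
    _ = _ := by rw [mul_pow_eq hp hpα, pow_mul_eq hp hpα]

theorem compressedEndo_compress {p : A} (hp : IsStarProjection p)
    (hpα : p * α p = p) (x : A) :
    compressedEndo α p hp (compress p hp x) = compress p hp (α x) := by
  have := compress_pow_compress hp hpα 1 x
  rwa [pow_one] at this

theorem compressedEndo_pow_compress {p : A} (hp : IsStarProjection p)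
    (hpα : p * α p = p) (n : ℕ) (x : A) :
    (compressedEndo α p hp ^ n) (compress p hp x) = compress p hp ((α ^ n) x) := by
  induction n with
  | zero => rfl
  | succ n ih =>
    rw [pow_succ', Module.End.mul_apply, ih, compressedEndo_compress hp hpα, pow_succ_apply']

end Endomorphism

variable [WeakOp A] [IsWAlg A]

theorem isWStar_corner : IsWStar (corner p hp) := by
  refine SubCStar.isWStar _ fun u a _ ha => (mem_corner hp).2 ?_
  refine wlim_unique ((IsWAlg.mul_right _ p).comp ((IsWAlg.mul_left a p).comp ha)) (ha.congr ?_)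
  intro x
  exact ((mem_corner hp).1 x.2).symm

theorem isNormalMap_compress : IsNormalMap (compress p hp) := by
  have := isWStar_corner hp
  refine IsWMap.isNormalMap (Φ := (compress p hp).mkContinuous 1 fun x => ?_) ?_
  · have h := IsStarProjection.norm_le _ hp
    rw [one_mul]
    calc ‖p * x * p‖ ≤ ‖p‖ * ‖x‖ * ‖p‖ := (norm_mul_le _ _).trans (by gcongr; exact norm_mul_le _ _)
      _ ≤ 1 * ‖x‖ * 1 := by gcongr
      _ = ‖x‖ := by ring
  · intro l a C _ _ hl
    refine SubCStar.tendsto_wnhds.2 ?_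
    exact (IsWAlg.mul_right _ p).comp ((IsWAlg.mul_left a p).comp hl)

theorem isUCP_compress {B : Type*} [CStarAlgebra B] [WeakOp B] {E : B →⋆ₐ[ℂ] A}
    (hE : IsNormalMap E) : IsUCP (compress p hp ∘ₗ E.toAlgHom.toLinearMap) where
  map_one := (congrArg (compress p hp) (map_one E)).trans (compress_one hp)
  completelyPositive := exists_completelyPositive hp (E : B →⋆ₙₐ[ℂ] A) _ fun _ => rfl
  normal := isNormalMap_comp (Ψ := compress p hp) (Φ := E) (isNormalMap_compress hp) hE

variable {α : A →⋆ₐ[ℂ] A}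

theorem isUCP_compressedEndo {p : A} (hp : IsStarProjection p)
    (hpα : p * α p = p) (hα : IsNormalMap α) : IsUCP (compressedEndo α p hp) where
  map_one := by
    rw [← compress_one hp, compressedEndo_compress hp hpα, map_one]
  completelyPositive := exists_completelyPositive hp
    ((α : A →⋆ₙₐ[ℂ] A).comp (corner p hp).inclHom) _ fun _ => rfl
  normal := isNormalMap_comp (Ψ := compress p hp) (isNormalMap_compress hp)
    (isNormalMap_comp (Ψ := α) hα (corner p hp).isNormalMap_incl)

/-- Pull `ρ` back along the compression to `τ` on `A`. Compression and inclusion are contractive on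
matrices, so the norms for `τ` and `α^n` equal those for `ρ` and `φ^n`, and the limit for `α`
applies. -/
theorem tendsto_normComp_compress {p : A} (hp : IsStarProjection p)
    (hpα : p * α p = p) (hα : IsNormalMap α) (D : TailDecomposition α) {k : ℕ}
    (ρ : Fin k → Fin k → predual (corner p hp)) :
    Tendsto (fun n : ℕ => normComp ρ (compressedEndo α p hp ^ n)) atTop
      (𝓝 (normComp ρ (compress p hp ∘ₗ D.E.toAlgHom.toLinearMap))) := by
  choose σ hσ1 hσ2 using fun i j => isNormalMap_compress hp (ρ i j).1 (ρ i j).2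
  let τ : Fin k → Fin k → predual A := fun i j => ⟨σ i j, hσ1 i j⟩
  have h1 : ∀ n : ℕ, normComp τ (α ^ n : A →⋆ₐ[ℂ] A).toAlgHom.toLinearMap =
      normComp ρ (compressedEndo α p hp ^ n) := by
    intro n
    refine le_antisymm (normComp_le (compress p hp) (norm_map_compress_le hp) fun i j x => ?_)
      (normComp_le (corner p hp).incl (fun X => (norm_map_incl _ X).le) fun i j x => ?_)
    · rw [compressedEndo_pow_compress hp hpα]
      exact hσ2 i j _
    · conv_lhs => rw [← compress_incl hp x, compressedEndo_pow_compress hp hpα]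
      exact (hσ2 i j _).symm
  have h2 : normComp τ D.E.toAlgHom.toLinearMap =
      normComp ρ (compress p hp ∘ₗ D.E.toAlgHom.toLinearMap) :=
    le_antisymm
      (normComp_le (fun x => x) (fun X => le_rfl) fun i j x => hσ2 i j _)
      (normComp_le (fun x => x) (fun X => le_rfl) fun i j x => (hσ2 i j _).symm)
  rw [← h2]
  simpa only [h1] using D.tendsto_normComp hα τ

/-- If the projections `α^n(p)` exhaust the unit, then the lift of the compression is
nondegenerate. -/
theorem isAsymptoticLift_compress {p : A} (hp : IsStarProjection p)
    (hpα : p * α p = p) (hα : IsNormalMap α)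
    (hlim : ∀ a : A, (∀ n : ℕ, (α ^ n) p * a * (α ^ n) p = 0) → a = 0) (D : TailDecomposition α) :
    IsAsymptoticLift (compressedEndo α p hp) D.liftAut
      (compress p hp ∘ₗ D.E.toAlgHom.toLinearMap) where
  isVonNeumann := (D.isEndoAsymptoticLift hα).isVonNeumann
  normal := D.isNormalMap_liftAut hα
  normal_symm := D.isNormalMap_liftAut_symm hα
  ucp := isUCP_compress hp (D.isNormalMap_E hα)
  equivariant x := by
    change compress p hp (D.E (D.liftAut x)) = compressedEndo α p hp (compress p hp (D.E x))
    rw [compressedEndo_compress hp hpα, D.E_liftAut]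
  nondegenerate x hx := by
    -- Apply `α^m` to the vanishing compression at time `n - m`: equivariance moves `E` to time `n`
    -- and replaces `p` by `α^m(p)`.
    refine D.eq_zero_of_E_zpow x fun n => hlim _ fun m => ?_
    have h1 : p * D.E ((D.liftAut ^ (n - m)) x) * p = 0 :=
      congrArg (corner p hp).incl (hx (n - m))
    have h2 : D.E ((D.liftAut ^ n) x) = (α ^ m) (D.E ((D.liftAut ^ (n - m)) x)) := by
      rw [← D.E_liftAut_pow, ← StarAlgEquiv.mul_apply, ← zpow_natCast, ← zpow_add,
        add_sub_cancel]
    rw [h2, ← map_mul, ← map_mul, h1, map_zero]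
  tendsto_norm _ ρ := tendsto_normComp_compress hp hpα hα D ρ

end Compression

/-- A bounded operator compressed to zero by projections that converge strongly to the identity
vanishes. -/
theorem eq_zero_of_compressions {H : Type*} [NormedAddCommGroup H] [InnerProductSpace ℂ H]
    [CompleteSpace H] {q : ℕ → H →L[ℂ] H} (hq : ∀ n, IsStarProjection (q n))
    (hlim : ∀ ξ : H, Tendsto (fun n => q n ξ) atTop (𝓝 ξ)) {a : H →L[ℂ] H}
    (ha : ∀ n, q n * a * q n = 0) : a = 0 := by
  refine ContinuousLinearMap.ext fun x => ext_inner_left ℂ fun y => ?_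
  have h1 : Tendsto (fun n => inner ℂ (q n y) (a (q n x))) atTop (𝓝 (inner ℂ y (a x))) :=
    (hlim y).inner ((a.continuous.tendsto x).comp (hlim x))
  have h2 : ∀ n, inner ℂ (q n y) (a (q n x)) = 0 := by
    intro n
    have h3 : ContinuousLinearMap.adjoint (q n) = q n := (hq n).isSelfAdjoint.star_eq
    have h4 := DFunLike.congr_fun (ha n) x
    have h5 := ContinuousLinearMap.adjoint_inner_left (q n) (a (q n x)) y
    rw [h3] at h5
    rw [h5]
    change inner ℂ y ((q n * a * q n) x) = 0
    rw [h4]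
    simp
  simp only [h2] at h1
  rw [← tendsto_nhds_unique tendsto_const_nhds h1]
  simp

end AsymptoticLift

end

/-! ### The asymptotic lifts of an endomorphism and of its compression. -/

theorem theorem4p1 {H : Type*} [NormedAddCommGroup H] [InnerProductSpace ℂ H] [CompleteSpace H]
    (N : VonNeumannAlgebra H)
    (α : N.toStarSubalgebra →⋆ₐ[ℂ] N.toStarSubalgebra) (hα : AsymptoticLift.IsNormalMap α)
    (p : N.toStarSubalgebra) (hp : IsStarProjection p)
    (hpα : (p : H →L[ℂ] H) ≤ (α p : H →L[ℂ] H))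
    (hlim : ∀ ξ : H, Tendsto (fun n : ℕ => ((α ^ n) p : H →L[ℂ] H) ξ) atTop (𝓝 ξ)) :
    AsymptoticLift.IsUCP (AsymptoticLift.compressedEndo α p hp) ∧
    Nonempty (AsymptoticLift.TailDecomposition α) ∧
    ∀ D : AsymptoticLift.TailDecomposition α,
      AsymptoticLift.IsEndoAsymptoticLift α D.liftAut D.E ∧
      AsymptoticLift.IsAsymptoticLift (AsymptoticLift.compressedEndo α p hp) D.liftAut
        (AsymptoticLift.compress p hp ∘ₗ D.E.toAlgHom.toLinearMap) := by
  have hcoe : ∀ q : N.toStarSubalgebra, IsStarProjection q → IsStarProjection (q : H →L[ℂ] H) :=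
    fun q hq => hq.map N.toStarSubalgebra.subtype
  have hmul : p * α p = p :=
    Subtype.ext (((hcoe p hp).le_iff_mul_eq_left (hcoe _ (hp.map α))).1 hpα)
  refine ⟨AsymptoticLift.isUCP_compressedEndo hp hmul hα,
    AsymptoticLift.nonempty_tailDecomposition hα, fun D => ⟨D.isEndoAsymptoticLift hα,
    AsymptoticLift.isAsymptoticLift_compress hp hmul hα (fun a ha => Subtype.ext ?_) D⟩⟩
  exact AsymptoticLift.eq_zero_of_compressions (fun n => hcoe _ (hp.map (α ^ n))) hlim
    fun n => congrArg Subtype.val (ha n)
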